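/- Let $m,n,n_1,\dots,n_m\ge 0$ be integers, let $c_1,\dots,c_m>0$ be real numbers and let $B_i\colon\mathbb R^n\to\mathbb R^{n_i}$ ($i\le m$) be linear and onto. Assume that there is a symmetric positive definite $n\times n$ matrix $A$ such that $$A^{-1}=\sum_{i=1}^m c_i\,B_i^*\,(B_iAB_i^*)^{-1}B_i .$$ The reversed Brascamp–Lieb constant $C_r$ is the smallest constant such that, for all non-negative measurable functions $f_i\colon\mathbb R^{n_i}\to\mathbb R$ ($i\le m$) and $f\colon\mathbb R^n\to\mathbb R$ satisfying $$\prod_{i=1}^m f_i(x_i)^{c_i}\le f\Bigl(\sum_{i=1}^m c_iB_i^*x_i\Bigr)\qquad\text{for all }(x_1,\dots,x_m)\in\mathbb R^{n_1}\times\dots\times\mathbb R^{n_m},\tag{1}$$ one has $$\prod_{i=1}^m\Bigl(\int_{\mathbb R^{n_i}}f_i\,dx\Bigr)^{c_i}\le C_r\int_{\mathbb R^n}f\,dx \tag{2}$$ (the integrals take values in $[0,\infty]$, with $0\cdot\infty=0$). Then $$C_r=\Bigl(\frac{\det A}{\prod_{i=1}^m\det(B_iAB_i^*)^{c_i}}\Bigr)^{1/2}.$$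 Moreover the Gaussian functions $f_i(x)=e^{-\langle B_iAB_i^*x,x\rangle/2}$ ($i\le m$) and $f(x)=e^{-\langle Ax,x\rangle/2}$ satisfy (1), have positive finite integrals, and give equality in (2). -/

import Mathlib

open MeasureTheory
open scoped Matrix ENNReal

noncomputable section

/-- A Brascamp–Lieb datum on `ℝⁿ`: positive exponents `c i` and linear onto maps
`B i : ℝⁿ → ℝ^(d i)`, given by their matrices in the standard bases (so that the adjoint of `B i`
is the transpose). -/
structure IsBrascampLiebDatum {m n : ℕ} {d : Fin m → ℕ} (c : Fin m → ℝ)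
    (B : (i : Fin m) → Matrix (Fin (d i)) (Fin n) ℝ) : Prop where
  pos : ∀ i, 0 < c i
  onto : ∀ i, Function.Surjective (fun x : Fin n → ℝ => B i *ᵥ x)

/-- The functions `f₁, …, f_m, f` that are tested in the reversed Brascamp–Lieb inequality:
non-negative, Lebesgue measurable, with `∏ fᵢ(xᵢ)^cᵢ ≤ f (∑ cᵢ Bᵢ* xᵢ)` for all `x₁, …, x_m`. -/
structure IsReversedAdmissible {m n : ℕ} {d : Fin m → ℕ} (c : Fin m → ℝ)
    (B : (i : Fin m) → Matrix (Fin (d i)) (Fin n) ℝ)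
    (f : (i : Fin m) → (Fin (d i) → ℝ) → ℝ) (g : (Fin n → ℝ) → ℝ) : Prop where
  nonneg_left : ∀ i x, 0 ≤ f i x
  nonneg_right : ∀ x, 0 ≤ g x
  measurable_left : ∀ i, AEMeasurable (f i) volume
  measurable_right : AEMeasurable g volume
  le : ∀ x : (i : Fin m) → (Fin (d i) → ℝ),
    ∏ i, f i (x i) ^ c i ≤ g (∑ i, c i • ((B i)ᵀ *ᵥ x i))

/-- The reversed Brascamp–Lieb inequality with constant `C`. The integrals take values in
`[0, ∞]`. -/
def ReversedBrascampLiebWith {m n : ℕ} {d : Fin m → ℕ} (c : Fin m → ℝ)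
    (B : (i : Fin m) → Matrix (Fin (d i)) (Fin n) ℝ) (C : ℝ≥0∞) : Prop :=
  ∀ (f : (i : Fin m) → (Fin (d i) → ℝ) → ℝ) (g : (Fin n → ℝ) → ℝ),
    IsReversedAdmissible c B f g →
      ∏ i, (∫⁻ x, ENNReal.ofReal (f i x)) ^ c i ≤ C * ∫⁻ x, ENNReal.ofReal (g x)

/-- `C` is the reversed Brascamp–Lieb constant: the smallest constant for which the reversed
inequality holds. -/
def IsReversedBrascampLiebConstant {m n : ℕ} {d : Fin m → ℕ} (c : Fin m → ℝ)
    (B : (i : Fin m) → Matrix (Fin (d i)) (Fin n) ℝ) (C : ℝ≥0∞) : Prop :=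
  IsLeast {C' : ℝ≥0∞ | ReversedBrascampLiebWith c B C'} C

/-- The centred Gaussian function `x ↦ exp (-⟨M x, x⟩ / 2)`. -/
def gaussianFun {k : ℕ} (M : Matrix (Fin k) (Fin k) ℝ) (x : Fin k → ℝ) : ℝ :=
  Real.exp (-((M *ᵥ x) ⬝ᵥ x) / 2)

/-- The number `(det A / ∏ det (Bᵢ A Bᵢ*)^cᵢ)^(1/2)`. -/
def brascampLiebValue {m n : ℕ} {d : Fin m → ℕ} (c : Fin m → ℝ)
    (B : (i : Fin m) → Matrix (Fin (d i)) (Fin n) ℝ) (A : Matrix (Fin n) (Fin n) ℝ) : ℝ :=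
  Real.sqrt (A.det / ∏ i, (B i * A * (B i)ᵀ).det ^ c i)

end

/-!
The linear change of variables `A = S Sᵀ`, `B i A (B i)ᵀ = T i (T i)ᵀ` turns the hypothesis on `A`
into the statement that `J i = Sᵀ (B i)ᵀ (T i)⁻ᵀ` are isometries with `∑ c i • J i (J i)ᵀ = 1`
(`exists_normalization`), and the constant into `1`. For such a geometric datum the inequality is
obtained from the heat semigroup `heat t`, in a discrete version of the stochastic proofs of
Borell and Lehec.

If `∏ uᵢ(xᵢ)^cᵢ ≤ g(∑ cᵢ Jᵢ xᵢ)`, then this relation survives an infinitesimal step of the heat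
flow. By the Cameron–Martin formula and Jensen's inequality, with `Y` a standard Gaussian vector,
`log (heat t g) x ≥ E log g (x + t v + √t Y) - t ‖v‖² / 2` for every drift `v`
(`le_heat_of_expFun_le`); and for a regular function `u = exp φ` the drift `v = ∇φ x` gives
equality up to `O(t²)` (`exists_heat_expFun_le`). The law of `Y` is carried by `(J i)*` to the
standard Gaussian law, the drifts `vᵢ = ∇φᵢ(xᵢ)` add up to `v = ∑ cᵢ Jᵢ vᵢ`, and `‖v‖² ≤ ∑ cᵢ
‖vᵢ‖²`; this is `IsGeometricDatum.exists_prod_heat_le`. The regularity that this needs, a Taylor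
estimate uniform in space, holds with constants independent of time for all log-Lipschitz
functions once these have been mollified by the heat flow (`exists_hasUniformTaylor_logHeat`). So
`N` steps of length `1 / N` have a total error `O(1 / N)`, and the inequality for the standard
Gaussian measures follows for log-Lipschitz functions (`IsGeometricDatum.prod_heat_one_le`).

Upper semicontinuous functions with compact support are decreasing limits of log-Lipschitz
sup-convolutions, and compactness shows that no mass is gained in the limit
(`IsGeometricDatum.prod_lintegral_stdGaussian_le`). Dilating the functions turns the Gaussian
measures into multiples of Lebesgue measure, the normalising constants cancelling because `∑ cᵢ
dim Fᵢ = dim E`; approximation from below by upper semicontinuous functions gives the general case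
(`IsGeometricDatum.prod_lintegral_le`).

The Gaussian functions are admissible by `‖∑ cᵢ Jᵢ yᵢ‖² ≤ ∑ cᵢ ‖yᵢ‖²`, and computing their
integrals shows that they give equality, so that no smaller constant is possible.
-/

/-! ### The standard Gaussian measure -/

section Gaussian

open ProbabilityTheory Filter Topology
open scoped RealInnerProductSpace NNReal

variable {E : Type*} [NormedAddCommGroup E] [InnerProductSpace ℝ E] [FiniteDimensional ℝ E]
  [MeasurableSpace E] [BorelSpace E]

theorem stdGaussian_eq_withDensity :
    stdGaussian E = (volume : Measure E).withDensity (fun x => ENNReal.ofReal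
      (((2 * Real.pi) ^ (Module.finrank ℝ E / 2 : ℝ))⁻¹ * Real.exp (-‖x‖ ^ 2 / 2))) := by
  set κ : ℝ := (2 * Real.pi) ^ (Module.finrank ℝ E / 2 : ℝ) with hκ
  have hκ0 : 0 < κ := by positivity
  have hint : ∫ v : E, Real.exp (-‖v‖ ^ 2 / 2) = κ := by
    have := GaussianFourier.integral_rexp_neg_mul_sq_norm (V := E) (b := 1 / 2) (by norm_num)
    rw [hκ, show (2 * Real.pi) = Real.pi / (1 / 2) by ring, ← this]
    congr 1; ext v; congr 1; ring
  have hI : Integrable (fun v : E => Real.exp (-‖v‖ ^ 2 / 2)) := by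
    by_contra h
    rw [integral_undef h] at hint
    exact hκ0.ne hint
  have hI' : Integrable (fun v : E => κ⁻¹ * Real.exp (-‖v‖ ^ 2 / 2)) := hI.const_mul _
  have hfin : IsFiniteMeasure ((volume : Measure E).withDensity (fun x => ENNReal.ofReal
      (κ⁻¹ * Real.exp (-‖x‖ ^ 2 / 2)))) :=
    isFiniteMeasure_withDensity_ofReal hI'.2
  apply Measure.ext_of_charFun
  ext t
  rw [charFun_stdGaussian, charFun_apply, integral_withDensity_eq_integral_toReal_smul
    (by fun_prop) (by simp)]
  have h := GaussianFourier.integral_cexp_neg_mul_sq_norm_add (V := E) (b := 1 / 2) (by norm_num)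
    Complex.I t
  have e1 : ∀ x : E, (ENNReal.ofReal (κ⁻¹ * Real.exp (-‖x‖ ^ 2 / 2))).toReal •
      Complex.exp (⟪x, t⟫ * Complex.I) =
      (κ⁻¹ : ℂ) * Complex.exp (-(1 / 2) * ‖x‖ ^ 2 + Complex.I * ⟪t, x⟫) := by
    intro x
    rw [ENNReal.toReal_ofReal (by positivity), Complex.real_smul]
    push_cast
    rw [mul_assoc, ← Complex.exp_add, real_inner_comm]
    congr 2; ring
  simp_rw [e1]
  rw [integral_const_mul, h]
  have e2 : ((Real.pi : ℂ) / (1 / 2)) ^ ((Module.finrank ℝ E : ℂ) / 2) = (κ : ℂ) := by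
    rw [hκ, Complex.ofReal_cpow (by positivity)]
    push_cast; congr 1; ring
  rw [e2, ← mul_assoc, inv_mul_cancel₀ (by exact_mod_cast hκ0.ne'), one_mul]
  congr 1
  simp only [Complex.I_sq]; ring

/-- The **Cameron–Martin formula**. -/
theorem stdGaussian_map_add_right (a : E) :
    (stdGaussian E).map (· + a) = (stdGaussian E).withDensity
      (fun x => ENNReal.ofReal (Real.exp (⟪x, a⟫ - ‖a‖ ^ 2 / 2))) := by
  refine Measure.ext_of_lintegral _ fun f hf => ?_
  rw [lintegral_map hf (by fun_prop), lintegral_withDensity_eq_lintegral_mul _ (by fun_prop) hf,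
    stdGaussian_eq_withDensity,
    lintegral_withDensity_eq_lintegral_mul _ (by fun_prop) (by fun_prop),
    lintegral_withDensity_eq_lintegral_mul _ (by fun_prop) (by fun_prop)]
  rw [← lintegral_add_right_eq_self _ (-a)]
  refine lintegral_congr fun x => ?_
  simp only [Pi.mul_apply, neg_add_cancel_right, ← mul_assoc]
  rw [← ENNReal.ofReal_mul (by positivity), mul_assoc _ (Real.exp _), ← Real.exp_add]
  congr 4
  rw [← sub_eq_add_neg, norm_sub_sq_real]; ring

theorem lintegral_stdGaussian_add_right (a : E) (f : E → ℝ≥0∞) :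
    ∫⁻ x, f x ∂stdGaussian E =
      ∫⁻ x, f (x + a) * ENNReal.ofReal (Real.exp (-⟪x, a⟫ - ‖a‖ ^ 2 / 2)) ∂stdGaussian E := by
  have h := stdGaussian_map_add_right (-a)
  have e : ∫⁻ x, f x ∂stdGaussian E =
      ∫⁻ x, f (x + a) ∂((stdGaussian E).map (· + -a)) := by
    rw [(measurableEmbedding_addRight (-a)).lintegral_map]
    simp
  rw [e, h, lintegral_withDensity_eq_lintegral_mul_non_measurable _ (by fun_prop)
    (by simp)]
  refine lintegral_congr fun x => ?_
  simp [mul_comm]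

theorem integral_stdGaussian_add_right (a : E) (f : E → ℝ) :
    ∫ x, f (x + a) ∂stdGaussian E =
      ∫ x, f x * Real.exp (⟪x, a⟫ - ‖a‖ ^ 2 / 2) ∂stdGaussian E := by
  have e : ∫ x, f (x + a) ∂stdGaussian E = ∫ x, f x ∂((stdGaussian E).map (· + a)) := by
    rw [(measurableEmbedding_addRight a).integral_map]
  rw [e, stdGaussian_map_add_right, integral_withDensity_eq_integral_toReal_smul
    (by fun_prop) (by simp)]
  refine integral_congr_ae (.of_forall fun x => ?_)
  simp [ENNReal.toReal_ofReal (Real.exp_pos _).le, mul_comm]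

theorem integrable_exp_mul_norm_stdGaussian (a : ℝ) :
    Integrable (fun x : E => Real.exp (a * ‖x‖)) (stdGaussian E) := by
  obtain ⟨C, hC, h⟩ := IsGaussian.exists_integrable_exp_sq (stdGaussian E)
  refine (h.const_mul (Real.exp (a ^ 2 / (4 * C)))).mono' (by fun_prop) (.of_forall fun x => ?_)
  rw [Real.norm_eq_abs, abs_of_pos (Real.exp_pos _), ← Real.exp_add, Real.exp_le_exp]
  have : 0 ≤ (a / (2 * C) - ‖x‖) ^ 2 * C := by positivity
  have e : (a / (2 * C) - ‖x‖) ^ 2 * C = a ^ 2 / (4 * C) - a * ‖x‖ + C * ‖x‖ ^ 2 := by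
    field_simp; ring
  linarith

theorem integrable_pow_mul_exp_norm_stdGaussian (n : ℕ) (a b : ℝ) :
    Integrable (fun x : E => (‖x‖ + b) ^ n * Real.exp (a * ‖x‖)) (stdGaussian E) := by
  refine ((integrable_exp_mul_norm_stdGaussian (E := E) (a + 1)).const_mul
    (n.factorial * Real.exp |b|)).mono' (by fun_prop) (.of_forall fun x => ?_)
  rw [norm_mul, Real.norm_eq_abs (Real.exp _), abs_of_pos (Real.exp_pos _), norm_pow,
    Real.norm_eq_abs, add_mul, one_mul, add_comm (a * ‖x‖), Real.exp_add, ← mul_assoc,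
    mul_assoc _ (Real.exp |b|),
    ← Real.exp_add]
  gcongr
  have h1 : |‖x‖ + b| ≤ |b| + ‖x‖ := by
    rw [add_comm]; exact (abs_add_le _ _).trans (by simp)
  have h2 := Real.pow_div_factorial_le_exp (x := |b| + ‖x‖) (by positivity) n
  rw [div_le_iff₀ (by positivity)] at h2
  calc _ ≤ (|b| + ‖x‖) ^ n := by gcongr
    _ ≤ _ := by linarith

theorem stdGaussian_map_adjoint {F : Type*} [NormedAddCommGroup F] [InnerProductSpace ℝ F]
    [FiniteDimensional ℝ F] [MeasurableSpace F] [BorelSpace F] (J : F →ₗᵢ[ℝ] E) :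
    (stdGaussian E).map (ContinuousLinearMap.adjoint J.toContinuousLinearMap) = stdGaussian F := by
  apply Measure.ext_of_charFun
  ext t
  rw [charFun_stdGaussian, charFun_apply, integral_map (by fun_prop) (by fun_prop)]
  simp_rw [ContinuousLinearMap.adjoint_inner_left]
  rw [← charFun_apply, charFun_stdGaussian]
  simp

/-- The heat semigroup: `heat t u x` is the mean of `u` for the Gaussian law with mean `x` and
covariance `t`. -/
noncomputable def heat (t : ℝ) (u : E → ℝ≥0∞) (x : E) : ℝ≥0∞ :=
  ∫⁻ y, u (x + √t • y) ∂stdGaussian E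

theorem measurable_heat {t : ℝ} {u : E → ℝ≥0∞} (hu : Measurable u) : Measurable (heat t u) := by
  unfold heat
  exact Measurable.lintegral_prod_right' (f := fun p : E × E => u (p.1 + √t • p.2)) (by fun_prop)

theorem heat_heat {t r : ℝ} (ht : 0 ≤ t) (hr : 0 ≤ r) {u : E → ℝ≥0∞} (hu : Measurable u) :
    heat t (heat r u) = heat (t + r) u := by
  have hc : ∀ s : ℝ, 0 ≤ s → ∀ ξ : E, charFun ((stdGaussian E).map (fun y => √s • y)) ξ =
      Complex.exp (-(s * ‖ξ‖ ^ 2) / 2) := by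
    intro s hs ξ
    rw [charFun_map_smul, charFun_stdGaussian, norm_smul, Real.norm_eq_abs,
      abs_of_nonneg (Real.sqrt_nonneg _), ← Complex.ofReal_pow, mul_pow, Real.sq_sqrt hs]
    push_cast; rfl
  have hp : ∀ s : ℝ, IsProbabilityMeasure ((stdGaussian E).map (fun y => √s • y)) := fun s =>
    Measure.isProbabilityMeasure_map (by fun_prop)
  have key : (stdGaussian E).map (fun y => √t • y) ∗ (stdGaussian E).map (fun y => √r • y) =
      (stdGaussian E).map (fun y => √(t + r) • y) := by
    have := hp t; have := hp r; have := hp (t + r)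
    apply Measure.ext_of_charFun
    ext ξ
    rw [charFun_conv, hc _ ht, hc _ hr, hc _ (add_nonneg ht hr), ← Complex.exp_add]
    congr 1; push_cast; ring
  ext x
  have h := congrArg (fun μ : Measure E => ∫⁻ z, u (x + z) ∂μ) key
  have := hp t; have := hp r
  rw [Measure.lintegral_conv (by fun_prop), lintegral_map (by fun_prop) (by fun_prop),
    lintegral_map (by fun_prop) (by fun_prop)] at h
  rw [heat, heat, ← h]
  refine lintegral_congr fun y => ?_
  rw [lintegral_map (by fun_prop) (by fun_prop)]
  simp only [heat, add_assoc]

end Gaussian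

/-! ### Regularity of log-Lipschitz functions under the heat semigroup -/

section LogLipschitz

open ProbabilityTheory Filter Topology
open scoped RealInnerProductSpace NNReal

theorem Real.abs_exp_sub_one_sub_self_le (s : ℝ) :
    |Real.exp s - 1 - s| ≤ s ^ 2 * Real.exp |s| := by
  have h := Complex.norm_exp_sub_sum_le_norm_mul_exp (s : ℂ) 2
  simp only [Finset.sum_range_succ, Finset.sum_range_zero, zero_add, pow_zero, Nat.factorial,
    Nat.cast_one, div_one, pow_one, Complex.norm_real, Real.norm_eq_abs, sq_abs, mul_one,
    Nat.succ_eq_add_one] at h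
  have e : (Complex.exp s - (1 + (s : ℂ))) = ((Real.exp s - 1 - s : ℝ) : ℂ) := by
    push_cast; ring
  rwa [e, Complex.norm_real, Real.norm_eq_abs] at h

/-- The exponential of a real function, as a function with values in `[0, ∞]`. -/
noncomputable def expFun {E : Type*} (φ : E → ℝ) (x : E) : ℝ≥0∞ := ENNReal.ofReal (Real.exp (φ x))

section Normed

variable {E : Type*} [SeminormedAddCommGroup E]

theorem LipschitzWith.sub_le_norm {φ : E → ℝ} {L : ℝ≥0} (hφ : LipschitzWith L φ) (x h : E) :
    |φ (x + h) - φ x| ≤ L * ‖h‖ := by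
  simpa [Real.dist_eq] using hφ.dist_le_mul (x + h) x

theorem LipschitzWith.exp_add_le {φ : E → ℝ} {L : ℝ≥0} (hφ : LipschitzWith L φ) (x h : E) :
    Real.exp (φ (x + h)) ≤ Real.exp (φ x) * Real.exp (L * ‖h‖) := by
  rw [← Real.exp_add, Real.exp_le_exp]
  have := (abs_le.1 (hφ.sub_le_norm x h)).2
  linarith

theorem LipschitzWith.le_exp_add {φ : E → ℝ} {L : ℝ≥0} (hφ : LipschitzWith L φ) (x h : E) :
    Real.exp (φ x) * Real.exp (-L * ‖h‖) ≤ Real.exp (φ (x + h)) := by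
  rw [← Real.exp_add, Real.exp_le_exp]
  have := (abs_le.1 (hφ.sub_le_norm x h)).1
  linarith

theorem measurable_expFun [MeasurableSpace E] [BorelSpace E] {φ : E → ℝ} {L : ℝ≥0}
    (hφ : LipschitzWith L φ) :
    Measurable (expFun φ) := by
  have := hφ.continuous
  unfold expFun
  fun_prop

end Normed

section Inner

variable {E : Type*} [NormedAddCommGroup E] [InnerProductSpace ℝ E]

/-- A first order Taylor expansion of `φ` with a quadratic error term of size `K`, uniform over the
points of expansion, and with a gradient bounded by `K`. -/
def HasUniformTaylor (φ : E → ℝ) (K : ℝ) : Prop :=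
  ∀ x, ∃ v : E, ‖v‖ ≤ K ∧ ∀ h, |φ (x + h) - φ x - ⟪v, h⟫| ≤ K * ‖h‖ ^ 2

/-- A second order expansion, in the shift `a`, of the Cameron–Martin density. -/
theorem abs_exp_inner_sub_le (y : E) {a : E} (ha : ‖a‖ ≤ 1) :
    |Real.exp (⟪y, a⟫ - ‖a‖ ^ 2 / 2) - 1 - ⟪y, a⟫| ≤
      ‖a‖ ^ 2 * ((‖y‖ + 1) ^ 2 * Real.exp (‖y‖ + 1) + 1) := by
  set s := ⟪y, a⟫ - ‖a‖ ^ 2 / 2 with hs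
  have hs1 : |s| ≤ ‖a‖ * (‖y‖ + 1) := by
    have e1 := abs_real_inner_le_norm y a
    have e2 : |‖a‖ ^ 2 / 2| ≤ ‖a‖ := by
      rw [abs_of_nonneg (by positivity)]; nlinarith [norm_nonneg a]
    refine (abs_sub _ _).trans ?_
    linarith
  have hs2 : |s| ≤ ‖y‖ + 1 := hs1.trans (mul_le_of_le_one_left (by positivity) ha)
  have e3 := Real.abs_exp_sub_one_sub_self_le s
  have e4 : s ^ 2 * Real.exp |s| ≤ (‖a‖ * (‖y‖ + 1)) ^ 2 * Real.exp (‖y‖ + 1) := by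
    rw [← sq_abs s]; gcongr
  have e5 : Real.exp s - 1 - ⟪y, a⟫ = (Real.exp s - 1 - s) - ‖a‖ ^ 2 / 2 := by
    rw [hs]; ring
  have e6 : ‖a‖ ^ 2 * ((‖y‖ + 1) ^ 2 * Real.exp (‖y‖ + 1) + 1) =
      (‖a‖ * (‖y‖ + 1)) ^ 2 * Real.exp (‖y‖ + 1) + ‖a‖ ^ 2 := by ring
  rw [e5, e6]
  refine (abs_sub _ _).trans ?_
  rw [abs_of_nonneg (show 0 ≤ ‖a‖ ^ 2 / 2 by positivity)]
  linarith [sq_nonneg ‖a‖]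

end Inner

variable {E : Type*} [NormedAddCommGroup E] [InnerProductSpace ℝ E] [FiniteDimensional ℝ E]
  [MeasurableSpace E] [BorelSpace E]

theorem LipschitzWith.integrable_exp_comp_stdGaussian {φ : E → ℝ} {L : ℝ≥0}
    (hφ : LipschitzWith L φ) (x : E) (s : ℝ) :
    Integrable (fun y => Real.exp (φ (x + s • y))) (stdGaussian E) := by
  have := hφ.continuous
  refine ((integrable_exp_mul_norm_stdGaussian (E := E) (L * |s|)).const_mul
    (Real.exp (φ x))).mono' (by fun_prop) (.of_forall fun y => ?_)
  rw [Real.norm_eq_abs, abs_of_pos (Real.exp_pos _)]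
  refine (hφ.exp_add_le x _).trans_eq ?_
  rw [norm_smul, Real.norm_eq_abs, mul_assoc]

theorem LipschitzWith.integrable_comp_stdGaussian {φ : E → ℝ} {L : ℝ≥0}
    (hφ : LipschitzWith L φ) (x : E) (s : ℝ) :
    Integrable (fun y => φ (x + s • y)) (stdGaussian E) := by
  have := hφ.continuous
  have h1 : Integrable (fun y : E => ‖y‖) (stdGaussian E) :=
    (IsGaussian.integrable_id (μ := stdGaussian E)).norm
  refine ((integrable_const |φ x|).add (h1.const_mul (L * |s|))).mono' (by fun_prop)
    (.of_forall fun y => ?_)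
  have := hφ.sub_le_norm x (s • y)
  rw [norm_smul, Real.norm_eq_abs, ← mul_assoc] at this
  simp only [Pi.add_apply, Real.norm_eq_abs]
  calc |φ (x + s • y)| = |φ x + (φ (x + s • y) - φ x)| := by ring_nf
    _ ≤ _ := (abs_add_le _ _).trans (by linarith)

/-- The logarithm of the heat semigroup applied to `exp φ`, meaningful for Lipschitz `φ`. -/
noncomputable def logHeat (t : ℝ) (φ : E → ℝ) (x : E) : ℝ :=
  Real.log (∫ y, Real.exp (φ (x + √t • y)) ∂stdGaussian E)

theorem LipschitzWith.exp_logHeat {φ : E → ℝ} {L : ℝ≥0} (hφ : LipschitzWith L φ) (t : ℝ) (x : E) :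
    Real.exp (logHeat t φ x) = ∫ y, Real.exp (φ (x + √t • y)) ∂stdGaussian E :=
  Real.exp_log (integral_exp_pos (hφ.integrable_exp_comp_stdGaussian x _))

theorem LipschitzWith.expFun_logHeat {φ : E → ℝ} {L : ℝ≥0} (hφ : LipschitzWith L φ) (t : ℝ) :
    expFun (logHeat t φ) = heat t (expFun φ) := by
  ext x
  rw [expFun, hφ.exp_logHeat, heat, ofReal_integral_eq_lintegral_ofReal
    (hφ.integrable_exp_comp_stdGaussian x _) (.of_forall fun y => (Real.exp_pos _).le)]
  rfl

theorem LipschitzWith.logHeat {φ : E → ℝ} {L : ℝ≥0} (hφ : LipschitzWith L φ) (t : ℝ) :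
    LipschitzWith L (logHeat t φ) := by
  refine LipschitzWith.of_le_add_mul L fun x x' => ?_
  rw [← Real.exp_le_exp, Real.exp_add, hφ.exp_logHeat, hφ.exp_logHeat, ← integral_mul_const]
  refine integral_mono (hφ.integrable_exp_comp_stdGaussian x _)
    ((hφ.integrable_exp_comp_stdGaussian x' _).mul_const _) fun y => ?_
  have := hφ.exp_add_le (x' + √t • y) (x - x')
  rwa [show x' + √t • y + (x - x') = x + √t • y by abel, ← dist_eq_norm] at this

set_option maxHeartbeats 600000 in
/-- The heat flow regularises: after time `τ`, the logarithm of a log-Lipschitz function satisfies a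
uniform Taylor estimate whose constant depends on the Lipschitz constant and on `τ` only. -/
theorem exists_hasUniformTaylor_logHeat (L : ℝ≥0) {τ : ℝ} (hτ : 0 < τ) :
    ∃ K : ℝ, ∀ φ : E → ℝ, LipschitzWith L φ → HasUniformTaylor (_root_.logHeat τ φ) K := by
  set σ := √τ with hσ
  have hσ0 : 0 < σ := Real.sqrt_pos.2 hτ
  -- up to the factor `exp (φ x)`: a lower bound `k₀` for `heat τ (exp φ)`, and upper bounds `k₁`
  -- and `k₂` for the gradient and for the second order remainder
  set k₀ := ∫ y : E, Real.exp (-(L * σ) * ‖y‖) ∂stdGaussian E with hk₀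
  have hk₀0 : 0 < k₀ := integral_exp_pos (integrable_exp_mul_norm_stdGaussian _)
  set k₁ := ∫ y : E, ‖y‖ * Real.exp (L * σ * ‖y‖) ∂stdGaussian E with hk₁
  have hk₁i : Integrable (fun y : E => ‖y‖ * Real.exp (L * σ * ‖y‖)) (stdGaussian E) := by
    simpa using integrable_pow_mul_exp_norm_stdGaussian (E := E) 1 (L * σ) 0
  have hk₁0 : 0 ≤ k₁ := integral_nonneg fun y => by positivity
  set q : E → ℝ := fun y => (‖y‖ + 1) ^ 2 * Real.exp (‖y‖ + 1) + 1 with hq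
  set k₂ := ∫ y : E, Real.exp (L * σ * ‖y‖) * q y ∂stdGaussian E with hk₂
  have hk₂i : Integrable (fun y : E => Real.exp (L * σ * ‖y‖) * q y) (stdGaussian E) := by
    refine (((integrable_pow_mul_exp_norm_stdGaussian (E := E) 2 (L * σ + 1) 1).mul_const
      (Real.exp 1)).add (integrable_exp_mul_norm_stdGaussian (L * σ))).congr
      (.of_forall fun y => ?_)
    simp only [Pi.add_apply, hq, Real.exp_add, add_mul, one_mul]; ring
  have hk₂0 : 0 ≤ k₂ := integral_nonneg fun y => by positivity
  set V := k₁ / (k₀ * σ) with hV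
  have hV0 : 0 ≤ V := by positivity
  set K₁ := L ^ 2 * Real.exp (L * σ) + k₂ / (k₀ * σ ^ 2) with hK₁
  have hK₁0 : 0 ≤ K₁ := by positivity
  set K₂ := (L + V) / σ with hK₂
  have hK₂0 : 0 ≤ K₂ := by positivity
  refine ⟨V + K₁ + K₂, fun φ hφ x => ?_⟩
  have hcont := hφ.continuous
  set I := Real.exp (_root_.logHeat τ φ x) with hI
  have hI0 : 0 < I := Real.exp_pos _
  have hIint : I = ∫ y, Real.exp (φ (x + σ • y)) ∂stdGaussian E := hφ.exp_logHeat τ x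
  have hup : ∀ y, Real.exp (φ (x + σ • y)) ≤ Real.exp (φ x) * Real.exp (L * σ * ‖y‖) := by
    intro y
    refine (hφ.exp_add_le x _).trans_eq ?_
    rw [norm_smul, Real.norm_eq_abs, abs_of_pos hσ0, mul_assoc]
  have hIlow : Real.exp (φ x) * k₀ ≤ I := by
    rw [hIint, hk₀, ← integral_const_mul]
    refine integral_mono ((integrable_exp_mul_norm_stdGaussian _).const_mul _)
      (hφ.integrable_exp_comp_stdGaussian x _) fun y => ?_
    refine le_trans (le_of_eq ?_) (hφ.le_exp_add x _)
    simp only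
    rw [norm_smul, Real.norm_eq_abs, abs_of_pos hσ0, neg_mul, neg_mul, mul_assoc]
  have hwi : Integrable (fun y => Real.exp (φ (x + σ • y)) • y) (stdGaussian E) := by
    refine (hk₁i.const_mul (Real.exp (φ x))).mono' (by fun_prop) (.of_forall fun y => ?_)
    rw [norm_smul, Real.norm_eq_abs, abs_of_pos (Real.exp_pos _)]
    calc _ ≤ Real.exp (φ x) * Real.exp (L * σ * ‖y‖) * ‖y‖ := by gcongr; exact hup y
      _ = _ := by ring
  set w := ∫ y, Real.exp (φ (x + σ • y)) • y ∂stdGaussian E with hw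
  have hwn : ‖w‖ ≤ Real.exp (φ x) * k₁ := by
    rw [hw, hk₁, ← integral_const_mul]
    refine norm_integral_le_of_norm_le (hk₁i.const_mul _) (.of_forall fun y => ?_)
    rw [norm_smul, Real.norm_eq_abs, abs_of_pos (Real.exp_pos _)]
    calc _ ≤ Real.exp (φ x) * Real.exp (L * σ * ‖y‖) * ‖y‖ := by gcongr; exact hup y
      _ = _ := by ring
  -- `v` is the gradient of `logHeat τ φ` at `x`
  set v := (I * σ)⁻¹ • w with hv
  have hvn : ‖v‖ ≤ V := by
    rw [hv, norm_smul, Real.norm_eq_abs, abs_of_pos (by positivity), hV, inv_mul_le_iff₀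
      (by positivity)]
    refine hwn.trans ?_
    calc _ = (Real.exp (φ x) * k₀) * σ * (k₁ / (k₀ * σ)) := by field_simp
      _ ≤ _ := by gcongr
  refine ⟨v, by linarith, fun h => ?_⟩
  have hLip := (hφ.logHeat τ).sub_le_norm x h
  have hvh : |⟪v, h⟫| ≤ V * ‖h‖ := (abs_real_inner_le_norm v h).trans (by gcongr)
  rcases le_total σ ‖h‖ with hh | hh
  · -- far away, the estimate follows from the Lipschitz bounds
    have h1 : |_root_.logHeat τ φ (x + h) - _root_.logHeat τ φ x - ⟪v, h⟫| ≤ (L + V) * ‖h‖ :=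
      (abs_sub _ _).trans (by linarith)
    have h2 : (L + V) * ‖h‖ ≤ K₂ * ‖h‖ ^ 2 := by
      rw [hK₂, div_mul_eq_mul_div, le_div_iff₀ hσ0, pow_two, mul_assoc]
      gcongr
    have h3 : 0 ≤ (V + K₁) * ‖h‖ ^ 2 := by positivity
    linarith
  · -- close by, expand the Cameron–Martin density to second order
    set a := σ⁻¹ • h with ha
    have han : ‖a‖ = ‖h‖ / σ := by
      rw [ha, norm_smul, Real.norm_eq_abs, abs_of_pos (by positivity)]; ring
    have ha1 : ‖a‖ ≤ 1 := by rw [han, div_le_one hσ0]; exact hh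
    have hIh : Real.exp (_root_.logHeat τ φ (x + h)) = ∫ y, Real.exp (φ (x + σ • y)) *
        Real.exp (⟪y, a⟫ - ‖a‖ ^ 2 / 2) ∂stdGaussian E := by
      rw [hφ.exp_logHeat, ← integral_stdGaussian_add_right]
      refine integral_congr_ae (.of_forall fun y => ?_)
      simp only [ha, smul_add, smul_smul, mul_inv_cancel₀ hσ0.ne', one_smul]
      congr 2; abel
    have hIhi : Integrable (fun y => Real.exp (φ (x + σ • y)) *
        Real.exp (⟪y, a⟫ - ‖a‖ ^ 2 / 2)) (stdGaussian E) := by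
      by_contra hcon
      rw [integral_undef hcon] at hIh
      exact (Real.exp_pos _).ne' hIh
    have hwa : ⟪w, a⟫ = ∫ y, Real.exp (φ (x + σ • y)) * ⟪y, a⟫ ∂stdGaussian E := by
      rw [hw, real_inner_comm, ← integral_inner hwi]
      refine integral_congr_ae (.of_forall fun y => ?_)
      simp only [inner_smul_right, real_inner_comm]
    have hwai : Integrable (fun y => Real.exp (φ (x + σ • y)) * ⟪y, a⟫) (stdGaussian E) := by
      refine (hwi.inner_const a).congr (.of_forall fun y => ?_)
      simp only [real_inner_smul_left]
    have hdens : ∀ y : E, |Real.exp (⟪y, a⟫ - ‖a‖ ^ 2 / 2) - 1 - ⟪y, a⟫| ≤ ‖a‖ ^ 2 * q y :=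
      fun y => abs_exp_inner_sub_le y ha1
    have hsubi : Integrable (fun y => Real.exp (φ (x + σ • y)) *
        Real.exp (⟪y, a⟫ - ‖a‖ ^ 2 / 2) - Real.exp (φ (x + σ • y))) (stdGaussian E) :=
      hIhi.sub (hφ.integrable_exp_comp_stdGaussian x σ)
    have hmain : |Real.exp (_root_.logHeat τ φ (x + h)) - I - ⟪w, a⟫| ≤
        ‖a‖ ^ 2 * (Real.exp (φ x) * k₂) := by
      rw [hIh, hIint, hwa, ← integral_sub hIhi (hφ.integrable_exp_comp_stdGaussian x _),
        ← integral_sub hsubi hwai, hk₂,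
        ← integral_const_mul, ← integral_const_mul, ← Real.norm_eq_abs]
      refine norm_integral_le_of_norm_le ((hk₂i.const_mul _).const_mul _) (.of_forall fun y => ?_)
      rw [Real.norm_eq_abs]
      calc _ = |Real.exp (φ (x + σ • y)) *
            (Real.exp (⟪y, a⟫ - ‖a‖ ^ 2 / 2) - 1 - ⟪y, a⟫)| := by congr 1; ring
        _ = Real.exp (φ (x + σ • y)) * |Real.exp (⟪y, a⟫ - ‖a‖ ^ 2 / 2) - 1 - ⟪y, a⟫| := by
            rw [abs_mul, abs_of_pos (Real.exp_pos _)]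
        _ ≤ (Real.exp (φ x) * Real.exp (L * σ * ‖y‖)) * (‖a‖ ^ 2 * q y) := by
            gcongr
            · exact hup y
            · exact hdens y
        _ = _ := by ring
    set s := _root_.logHeat τ φ (x + h) - _root_.logHeat τ φ x with hs
    have hexps : Real.exp s = Real.exp (_root_.logHeat τ φ (x + h)) / I := by
      rw [hs, Real.exp_sub]
    have hvh2 : ⟪v, h⟫ = ⟪w, a⟫ / I := by
      rw [hv, ha, real_inner_smul_left, real_inner_smul_right]; field_simp
    -- `exp s - 1` is close both to `⟪v, h⟫` and to `s`
    have b1 : |Real.exp s - 1 - ⟪v, h⟫| ≤ k₂ / (k₀ * σ ^ 2) * ‖h‖ ^ 2 := by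
      rw [hexps, hvh2, show Real.exp (_root_.logHeat τ φ (x + h)) / I - 1 - ⟪w, a⟫ / I =
        (Real.exp (_root_.logHeat τ φ (x + h)) - I - ⟪w, a⟫) / I by field_simp, abs_div,
        abs_of_pos hI0, div_le_iff₀ hI0]
      refine hmain.trans ?_
      rw [han]
      calc (‖h‖ / σ) ^ 2 * (Real.exp (φ x) * k₂)
          = k₂ / (k₀ * σ ^ 2) * ‖h‖ ^ 2 * (Real.exp (φ x) * k₀) := by field_simp
        _ ≤ _ := by gcongr
    have b2 : |Real.exp s - 1 - s| ≤ L ^ 2 * Real.exp (L * σ) * ‖h‖ ^ 2 := by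
      refine (Real.abs_exp_sub_one_sub_self_le s).trans ?_
      rw [← sq_abs s]
      calc |s| ^ 2 * Real.exp |s| ≤ (L * ‖h‖) ^ 2 * Real.exp (L * σ) := by
            gcongr
            exact hLip.trans (by gcongr)
        _ = _ := by ring
    have b3 : |s - ⟪v, h⟫| ≤ K₁ * ‖h‖ ^ 2 := by
      calc |s - ⟪v, h⟫| = |(Real.exp s - 1 - ⟪v, h⟫) - (Real.exp s - 1 - s)| := by
            congr 1; ring
        _ ≤ _ := (abs_sub _ _).trans (by rw [hK₁]; linarith)
    have b4 : 0 ≤ (V + K₂) * ‖h‖ ^ 2 := by positivity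
    linarith

end LogLipschitz

/-! ### The inequality over a short time step -/

section Step

open ProbabilityTheory Filter Topology
open scoped RealInnerProductSpace NNReal

theorem ofReal_integral_le_lintegral_ofReal {α : Type*} [MeasurableSpace α] {μ : Measure α}
    {f : α → ℝ} (hf : Integrable f μ) :
    ENNReal.ofReal (∫ x, f x ∂μ) ≤ ∫⁻ x, ENNReal.ofReal (f x) ∂μ := by
  refine ENNReal.ofReal_le_of_le_toReal ?_
  rw [integral_eq_lintegral_pos_part_sub_lintegral_neg_part hf]
  linarith [ENNReal.toReal_nonneg (a := ∫⁻ x, ENNReal.ofReal (-f x) ∂μ)]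

/-- **Jensen's inequality** for the exponential. -/
theorem ofReal_exp_integral_le {α : Type*} [MeasurableSpace α] {μ : Measure α}
    [IsProbabilityMeasure μ] {f : α → ℝ} (hf : Integrable f μ) :
    ENNReal.ofReal (Real.exp (∫ x, f x ∂μ)) ≤ ∫⁻ x, ENNReal.ofReal (Real.exp (f x)) ∂μ := by
  set m := ∫ x, f x ∂μ with hm
  have hs : Integrable (fun x => f x - m) μ := hf.sub (integrable_const m)
  have hi : Integrable (fun x => Real.exp m * (1 + (f x - m))) μ :=
    ((integrable_const 1).add hs).const_mul _
  have h1 : ∫ x, Real.exp m * (1 + (f x - m)) ∂μ = Real.exp m := by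
    rw [integral_const_mul, integral_add (integrable_const _) hs,
      integral_sub hf (integrable_const m), ← hm]
    simp
  rw [← h1]
  refine (ofReal_integral_le_lintegral_ofReal hi).trans (lintegral_mono fun x => ?_)
  refine ENNReal.ofReal_le_ofReal ?_
  calc Real.exp m * (1 + (f x - m)) ≤ Real.exp m * Real.exp (f x - m) := by
        gcongr; linarith [Real.add_one_le_exp (f x - m)]
    _ = Real.exp (f x) := by rw [← Real.exp_add]; congr 1; ring

theorem prod_ofReal_exp_rpow {ι : Type*} (s : Finset ι) (c a : ι → ℝ) :
    ∏ i ∈ s, ENNReal.ofReal (Real.exp (a i)) ^ c i =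
      ENNReal.ofReal (Real.exp (∑ i ∈ s, c i * a i)) := by
  rw [Real.exp_sum, ENNReal.ofReal_prod_of_nonneg fun i _ => (Real.exp_pos _).le]
  refine Finset.prod_congr rfl fun i _ => ?_
  rw [ENNReal.ofReal_rpow_of_pos (Real.exp_pos _), ← Real.exp_mul, mul_comm]

section Datum

variable {E : Type*} [NormedAddCommGroup E] [InnerProductSpace ℝ E] [FiniteDimensional ℝ E]
  {ι : Type*} [Fintype ι] {F : ι → Type*} [∀ i, NormedAddCommGroup (F i)]
  [∀ i, InnerProductSpace ℝ (F i)] [∀ i, FiniteDimensional ℝ (F i)]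

/-- A geometric Brascamp–Lieb datum: positive weights `c i` and isometric embeddings `J i` into `E`
with `∑ c i • J i (J i)* = 1`. -/
structure IsGeometricDatum (c : ι → ℝ) (J : (i : ι) → F i →ₗᵢ[ℝ] E) : Prop where
  pos : ∀ i, 0 < c i
  frame : ∀ x : E, ∑ i, c i • J i (ContinuousLinearMap.adjoint (J i).toContinuousLinearMap x) = x

namespace IsGeometricDatum

variable {c : ι → ℝ} {J : (i : ι) → F i →ₗᵢ[ℝ] E}

theorem norm_sq_sum_le (h : IsGeometricDatum c J) (v : (i : ι) → F i) :
    ‖∑ i, c i • J i (v i)‖ ^ 2 ≤ ∑ i, c i * ‖v i‖ ^ 2 := by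
  set x := ∑ i, c i • J i (v i) with hx
  set B := fun i => ContinuousLinearMap.adjoint (J i).toContinuousLinearMap with hB
  have e0 : ∀ (w : (i : ι) → F i), ⟪x, ∑ i, c i • J i (w i)⟫ = ∑ i, c i * ⟪B i x, w i⟫ := by
    intro w
    rw [inner_sum]
    refine Finset.sum_congr rfl fun i _ => ?_
    rw [inner_smul_right, hB, ContinuousLinearMap.adjoint_inner_left]; rfl
  have e1 : ‖x‖ ^ 2 = ∑ i, c i * ⟪B i x, v i⟫ := by
    rw [← e0 v, ← hx, real_inner_self_eq_norm_sq]
  have e2 : ‖x‖ ^ 2 = ∑ i, c i * ‖B i x‖ ^ 2 := by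
    have := e0 (fun i => B i x)
    rw [h.frame x, real_inner_self_eq_norm_sq] at this
    simpa [real_inner_self_eq_norm_sq] using this
  have e3 : ∑ i, c i * ⟪B i x, v i⟫ ≤ ∑ i, c i * (‖B i x‖ ^ 2 / 2 + ‖v i‖ ^ 2 / 2) := by
    refine Finset.sum_le_sum fun i _ => mul_le_mul_of_nonneg_left ?_ (h.pos i).le
    have := real_inner_le_norm (B i x) (v i)
    nlinarith [sq_nonneg (‖B i x‖ - ‖v i‖)]
  simp only [mul_add, Finset.sum_add_distrib, mul_div_assoc'] at e3
  rw [← Finset.sum_div, ← Finset.sum_div, ← e2, ← e1] at e3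
  linarith

theorem norm_sum_le (h : IsGeometricDatum c J) (v : (i : ι) → F i) :
    ‖∑ i, c i • J i (v i)‖ ≤ ∑ i, c i * ‖v i‖ := by
  refine (_root_.norm_sum_le _ _).trans_eq (Finset.sum_congr rfl fun i _ => ?_)
  rw [norm_smul, Real.norm_eq_abs, abs_of_pos (h.pos i), LinearIsometry.norm_map]

end IsGeometricDatum

end Datum

variable {E : Type*} [NormedAddCommGroup E] [InnerProductSpace ℝ E] [FiniteDimensional ℝ E]
  [MeasurableSpace E] [BorelSpace E]

/-- The Cameron–Martin formula for the heat semigroup, with a drift `v`. -/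
theorem heat_eq_lintegral_drift {t : ℝ} (ht : 0 ≤ t) (g : E → ℝ≥0∞) (x v : E) :
    heat t g x = ∫⁻ y, g (x + t • v + √t • y) *
      ENNReal.ofReal (Real.exp (-(√t * ⟪v, y⟫) - t * ‖v‖ ^ 2 / 2)) ∂stdGaussian E := by
  rw [heat, lintegral_stdGaussian_add_right (√t • v)]
  refine lintegral_congr fun y => ?_
  congr 2
  · rw [smul_add, smul_smul, Real.mul_self_sqrt ht]; abel
  · rw [inner_smul_right, norm_smul, mul_pow, Real.norm_eq_abs, sq_abs, Real.sq_sqrt ht,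
      real_inner_comm]

/-- The Gibbs variational bound for `heat t g`, tested on a Gaussian with drift `v`. -/
theorem le_heat_of_expFun_le {t : ℝ} (ht : 0 ≤ t) {g : E → ℝ≥0∞} {W : E → ℝ}
    (hW : Integrable W (stdGaussian E)) (x v : E)
    (h : ∀ y, expFun W y ≤ g (x + t • v + √t • y)) :
    ENNReal.ofReal (Real.exp (∫ y, W y ∂stdGaussian E - t * ‖v‖ ^ 2 / 2)) ≤ heat t g x := by
  have hv : Integrable (fun y => ⟪v, y⟫) (stdGaussian E) :=
    (IsGaussian.integrable_id (μ := stdGaussian E)).const_inner v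
  have hv0 : ∫ y, ⟪v, y⟫ ∂stdGaussian E = 0 := integral_strongDual_stdGaussian (innerSL ℝ v)
  have hi : Integrable (fun y => -(√t * ⟪v, y⟫) - t * ‖v‖ ^ 2 / 2) (stdGaussian E) :=
    (hv.const_mul _).neg.sub (integrable_const _)
  have e : ∫ y, W y ∂stdGaussian E - t * ‖v‖ ^ 2 / 2 =
      ∫ y, (W y + (-(√t * ⟪v, y⟫) - t * ‖v‖ ^ 2 / 2)) ∂stdGaussian E := by
    have hn : Integrable (fun y => -(√t * ⟪v, y⟫)) (stdGaussian E) := (hv.const_mul _).neg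
    rw [integral_add hW hi, integral_sub hn (integrable_const _), integral_neg,
      integral_const_mul, hv0]
    simp [sub_eq_add_neg]
  rw [e, heat_eq_lintegral_drift ht g x v]
  refine (ofReal_exp_integral_le (hW.add hi)).trans (lintegral_mono fun y => ?_)
  simp only [Pi.add_apply]
  rw [Real.exp_add, ENNReal.ofReal_mul (Real.exp_pos _).le]
  gcongr
  exact h y

/-- For a function with a uniform Taylor expansion, the Gibbs variational principle is attained up
to an error `O(t²)` by the Gaussian whose drift is the gradient. -/
theorem exists_heat_expFun_le (L : ℝ≥0) (K : ℝ) :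
    ∃ C : ℝ, ∀ φ : E → ℝ, LipschitzWith L φ → ∀ x v : E, ‖v‖ ≤ K →
      (∀ h, |φ (x + h) - φ x - ⟪v, h⟫| ≤ K * ‖h‖ ^ 2) → ∀ t : ℝ, 0 ≤ t → t ≤ 1 →
      heat t (expFun φ) x ≤ ENNReal.ofReal (Real.exp
        (∫ y, φ (x + t • v + √t • y) ∂stdGaussian E - t * ‖v‖ ^ 2 / 2 + C * t ^ 2)) := by
  set q : E → ℝ := fun y => K ^ 2 * (‖y‖ + K) ^ 4 * Real.exp ((L + K) * (‖y‖ + K)) with hq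
  have hqi : Integrable q (stdGaussian E) := by
    refine ((integrable_pow_mul_exp_norm_stdGaussian (E := E) 4 (L + K) K).const_mul
      (K ^ 2 * Real.exp ((L + K) * K))).congr (.of_forall fun y => ?_)
    simp only [hq, mul_add, Real.exp_add]; ring
  refine ⟨∫ y, q y ∂stdGaussian E, fun φ hφ x v hv hT t ht ht1 => ?_⟩
  have hK : 0 ≤ K := (norm_nonneg v).trans hv
  -- the Taylor remainder `R` is `O(t)`, so that `exp R` and `1 + R` differ by `O(t²)`
  set R : E → ℝ := fun y => φ (x + t • v + √t • y) - φ x - ⟪v, t • v + √t • y⟫ with hR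
  have hs1 : √t ≤ 1 := Real.sqrt_le_one.2 ht1
  have hst : √t ^ 2 = t := Real.sq_sqrt ht
  have hvi : Integrable (fun y => ⟪v, y⟫) (stdGaussian E) :=
    (IsGaussian.integrable_id (μ := stdGaussian E)).const_inner v
  have hv0 : ∫ y, ⟪v, y⟫ ∂stdGaussian E = 0 := integral_strongDual_stdGaussian (innerSL ℝ v)
  have hRe : ∀ y, R y = φ (x + t • v + √t • y) - (φ x + t * ‖v‖ ^ 2 + √t * ⟪v, y⟫) := by
    intro y
    simp only [hR, inner_add_right, inner_smul_right, real_inner_self_eq_norm_sq]; ring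
  have hlin : Integrable (fun y => φ x + t * ‖v‖ ^ 2 + √t * ⟪v, y⟫) (stdGaussian E) :=
    (integrable_const _).add (hvi.const_mul _)
  have hφi := hφ.integrable_comp_stdGaussian (x + t • v) (√t)
  have hRi : Integrable R (stdGaussian E) := (hφi.sub hlin).congr (.of_forall fun y => (hRe y).symm)
  have hRint : ∫ y, R y ∂stdGaussian E =
      ∫ y, φ (x + t • v + √t • y) ∂stdGaussian E - (φ x + t * ‖v‖ ^ 2) := by
    simp_rw [hRe]
    rw [integral_sub hφi hlin, integral_add (integrable_const _) (hvi.const_mul _),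
      integral_const_mul, hv0]
    simp
  have hRb : ∀ y, Real.exp (R y) ≤ 1 + R y + t ^ 2 * q y := by
    intro y
    set h := t • v + √t • y with hh
    have hRh : R y = φ (x + h) - φ x - ⟪v, h⟫ := by
      simp only [hR, hh]; rw [add_assoc]
    have hn : ‖h‖ ≤ √t * (‖y‖ + K) := by
      refine (norm_add_le _ _).trans ?_
      rw [norm_smul, norm_smul, Real.norm_eq_abs, Real.norm_eq_abs, abs_of_nonneg ht,
        abs_of_nonneg (Real.sqrt_nonneg _), mul_add, add_comm]
      gcongr
      rw [← Real.sqrt_eq_one.2 rfl] at hs1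
      nlinarith [Real.sqrt_nonneg t, Real.sqrt_one]
    have hn1 : ‖h‖ ≤ ‖y‖ + K := hn.trans (mul_le_of_le_one_left (by positivity) hs1)
    have hR1 : |R y| ≤ t * (K * (‖y‖ + K) ^ 2) := by
      rw [hRh]
      refine (hT h).trans ?_
      calc K * ‖h‖ ^ 2 ≤ K * (√t * (‖y‖ + K)) ^ 2 := by gcongr
        _ = √t ^ 2 * (K * (‖y‖ + K) ^ 2) := by ring
        _ = _ := by rw [hst]
    have hR2 : |R y| ≤ (L + K) * (‖y‖ + K) := by
      rw [hRh]
      refine (abs_sub _ _).trans ?_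
      have e1 := hφ.sub_le_norm x h
      have e2 : |⟪v, h⟫| ≤ K * ‖h‖ := (abs_real_inner_le_norm v h).trans (by gcongr)
      calc _ ≤ (L + K) * ‖h‖ := by linarith
        _ ≤ _ := by gcongr
    have e3 := (abs_le.1 (Real.abs_exp_sub_one_sub_self_le (R y))).2
    have e4 : (R y) ^ 2 * Real.exp |R y| ≤ t ^ 2 * q y := by
      rw [← sq_abs, hq]
      calc |R y| ^ 2 * Real.exp |R y| ≤ (t * (K * (‖y‖ + K) ^ 2)) ^ 2 *
            Real.exp ((L + K) * (‖y‖ + K)) := by gcongr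
        _ = _ := by ring
    linarith
  set a := φ x + t * ‖v‖ ^ 2 / 2 with ha
  have h1R : Integrable (fun y => 1 + R y) (stdGaussian E) := (integrable_const 1).add hRi
  have hbi : Integrable (fun y => Real.exp a * (1 + R y + t ^ 2 * q y)) (stdGaussian E) :=
    (h1R.add (hqi.const_mul _)).const_mul _
  calc heat t (expFun φ) x
      = ∫⁻ y, ENNReal.ofReal (Real.exp a * Real.exp (R y)) ∂stdGaussian E := by
        rw [heat_eq_lintegral_drift ht _ x v]
        refine lintegral_congr fun y => ?_
        rw [expFun, ← ENNReal.ofReal_mul (Real.exp_pos _).le, ← Real.exp_add, ← Real.exp_add, hRe]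
        congr 2; rw [ha]; ring
    _ ≤ ∫⁻ y, ENNReal.ofReal (Real.exp a * (1 + R y + t ^ 2 * q y)) ∂stdGaussian E :=
        lintegral_mono fun y => ENNReal.ofReal_le_ofReal (by gcongr; exact hRb y)
    _ = ENNReal.ofReal (Real.exp a * (1 + ∫ y, R y ∂stdGaussian E +
          t ^ 2 * ∫ y, q y ∂stdGaussian E)) := by
        rw [← ofReal_integral_eq_lintegral_ofReal hbi (.of_forall fun y => mul_nonneg
          (Real.exp_pos _).le ((Real.exp_pos _).le.trans (hRb y))), integral_const_mul,
          integral_add h1R (hqi.const_mul _),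
          integral_add (integrable_const 1) hRi, integral_const_mul]
        simp
    _ ≤ _ := by
        refine ENNReal.ofReal_le_ofReal ?_
        have := Real.add_one_le_exp (∫ y, R y ∂stdGaussian E + t ^ 2 * ∫ y, q y ∂stdGaussian E)
        calc _ ≤ Real.exp a * Real.exp
              (∫ y, R y ∂stdGaussian E + t ^ 2 * ∫ y, q y ∂stdGaussian E) := by
              gcongr; linarith
          _ = _ := by
              rw [← Real.exp_add, hRint, ha]; congr 1; ring

namespace IsGeometricDatum

variable {ι : Type*} [Fintype ι] {F : ι → Type*} [∀ i, NormedAddCommGroup (F i)]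
  [∀ i, InnerProductSpace ℝ (F i)] [∀ i, FiniteDimensional ℝ (F i)]
  {c : ι → ℝ} {J : (i : ι) → F i →ₗᵢ[ℝ] E}
  [∀ i, MeasurableSpace (F i)] [∀ i, BorelSpace (F i)]

/-- Over a time `t ≤ 1`, the heat flow preserves the relation `∏ exp (φ i) ^ c i ≤ g` up to a factor
`exp (C t²)`, with `C` depending on the regularity of the functions `φ i` only. -/
theorem exists_prod_heat_le (h : IsGeometricDatum c J) (L : ι → ℝ≥0) (K : ι → ℝ) :
    ∃ C : ℝ, ∀ φ : (i : ι) → F i → ℝ, (∀ i, LipschitzWith (L i) (φ i)) →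
      (∀ i, HasUniformTaylor (φ i) (K i)) → ∀ g : E → ℝ≥0∞,
      (∀ x : (i : ι) → F i, ∏ i, expFun (φ i) (x i) ^ c i ≤ g (∑ i, c i • J i (x i))) →
      ∀ t : ℝ, 0 ≤ t → t ≤ 1 → ∀ x : (i : ι) → F i,
      ∏ i, heat t (expFun (φ i)) (x i) ^ c i ≤
        ENNReal.ofReal (Real.exp (C * t ^ 2)) * heat t g (∑ i, c i • J i (x i)) := by
  choose C hC using fun i => exists_heat_expFun_le (E := F i) (L i) (K i)
  refine ⟨∑ i, c i * C i, fun φ hφ hT g hg t ht ht1 x => ?_⟩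
  choose v hvn hv using fun i => hT i (x i)
  set B := fun i => ContinuousLinearMap.adjoint (J i).toContinuousLinearMap with hB
  -- both sides are compared with the expectations `m i` of the drifted Gaussians
  set m : ι → ℝ := fun i => ∫ y, φ i (x i + t • v i + √t • y) ∂stdGaussian (F i) with hm
  set V := ∑ i, c i • J i (v i) with hV
  have hi : ∀ i, Integrable (fun y => φ i (x i + t • v i + √t • B i y)) (stdGaussian E) := by
    intro i
    have := (hφ i).integrable_comp_stdGaussian (x i + t • v i) (√t)
    rw [← stdGaussian_map_adjoint (J i)] at this
    exact this.comp_measurable (by fun_prop)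
  have hmi : ∀ i, ∫ y, φ i (x i + t • v i + √t • B i y) ∂stdGaussian E = m i := by
    intro i
    have := (hφ i).continuous
    rw [hm]
    simp only
    rw [← stdGaussian_map_adjoint (J i), integral_map (by fun_prop)
      (Continuous.aestronglyMeasurable (by fun_prop))]
  set W : E → ℝ := fun y => ∑ i, c i * φ i (x i + t • v i + √t • B i y) with hW
  have hWi : Integrable W (stdGaussian E) := integrable_finsetSum _ fun i _ => (hi i).const_mul _
  have hWint : ∫ y, W y ∂stdGaussian E = ∑ i, c i * m i := by
    rw [hW, integral_finsetSum _ fun i _ => (hi i).const_mul _]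
    simp_rw [integral_const_mul, hmi]
  have hlow := le_heat_of_expFun_le (g := g) ht hWi (∑ i, c i • J i (x i)) V (by
    intro y
    have e : ∑ i, c i • J i (x i) + t • V + √t • y =
        ∑ i, c i • J i (x i + t • v i + √t • B i y) := by
      conv_lhs => rw [← h.frame y]
      simp only [map_add, map_smul, smul_add, Finset.sum_add_distrib, hV, Finset.smul_sum,
        smul_comm _ (c _)]
      rfl
    rw [e]
    refine le_trans (le_of_eq ?_) (hg _)
    simp only [expFun, prod_ofReal_exp_rpow, hW])
  calc ∏ i, heat t (expFun (φ i)) (x i) ^ c i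
      ≤ ∏ i, ENNReal.ofReal (Real.exp (m i - t * ‖v i‖ ^ 2 / 2 + C i * t ^ 2)) ^ c i := by
        gcongr with i
        · exact (h.pos i).le
        · exact hC i (φ i) (hφ i) (x i) (v i) (hvn i) (hv i) t ht ht1
    _ = ENNReal.ofReal (Real.exp ((∑ i, c i * C i) * t ^ 2 +
          (∑ i, c i * m i - t * (∑ i, c i * ‖v i‖ ^ 2) / 2))) := by
        rw [prod_ofReal_exp_rpow]
        congr 2
        rw [Finset.sum_mul, Finset.mul_sum, Finset.sum_div, ← Finset.sum_sub_distrib,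
          ← Finset.sum_add_distrib]
        refine Finset.sum_congr rfl fun i _ => by ring
    _ ≤ ENNReal.ofReal (Real.exp ((∑ i, c i * C i) * t ^ 2 +
          (∑ i, c i * m i - t * ‖V‖ ^ 2 / 2))) := by
        refine ENNReal.ofReal_le_ofReal (Real.exp_le_exp.2 ?_)
        have := mul_le_mul_of_nonneg_left (h.norm_sq_sum_le v) ht
        linarith
    _ ≤ _ := by
        rw [Real.exp_add, ENNReal.ofReal_mul (Real.exp_pos _).le, ← hWint]
        gcongr

end IsGeometricDatum

end Step

/-! ### The Gaussian inequality for log-Lipschitz functions -/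

section GaussianInequality

open ProbabilityTheory Filter Topology
open scoped RealInnerProductSpace NNReal

theorem ENNReal.tendsto_finsetProd_of_ne_zero {ι α : Type*} {l : Filter α} {s : Finset ι}
    {f : ι → α → ℝ≥0∞} {a : ι → ℝ≥0∞} (h : ∀ i ∈ s, Tendsto (f i) l (𝓝 (a i)))
    (ha : ∀ i ∈ s, a i ≠ 0) :
    Tendsto (fun x => ∏ i ∈ s, f i x) l (𝓝 (∏ i ∈ s, a i)) := by
  classical
  induction s using Finset.induction_on with
  | empty => simpa using tendsto_const_nhds
  | insert i s his ih =>
    simp only [Finset.prod_insert his]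
    refine ENNReal.Tendsto.mul (h i (by simp)) (.inl (ha i (by simp)))
      (ih (fun j hj => h j (by simp [hj])) fun j hj => ha j (by simp [hj])) (.inl ?_)
    exact Finset.prod_ne_zero_iff.2 fun j hj => ha j (by simp [hj])

variable {E : Type*} [NormedAddCommGroup E] [InnerProductSpace ℝ E] [FiniteDimensional ℝ E]
  [MeasurableSpace E] [BorelSpace E]

theorem heat_zero (u : E → ℝ≥0∞) : heat 0 u = u := by
  ext x; simp [heat]

theorem heat_const_mul {t : ℝ} {u : E → ℝ≥0∞} (hu : Measurable u) (a : ℝ≥0∞) :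
    heat t (fun x => a * u x) = fun x => a * heat t u x := by
  ext x
  exact lintegral_const_mul _ (by fun_prop)

theorem heat_comm {t r : ℝ} (ht : 0 ≤ t) (hr : 0 ≤ r) {u : E → ℝ≥0∞} (hu : Measurable u) :
    heat t (heat r u) = heat r (heat t u) := by
  rw [heat_heat ht hr hu, heat_heat hr ht hu, add_comm]

/-- The moment generating function of the norm of a standard Gaussian vector. -/
noncomputable def normMgf (E : Type*) [NormedAddCommGroup E] [InnerProductSpace ℝ E]
    [FiniteDimensional ℝ E] [MeasurableSpace E] (a : ℝ) : ℝ :=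
  ∫ y : E, Real.exp (a * ‖y‖) ∂stdGaussian E

theorem tendsto_normMgf {α : Type*} {l : Filter α} {a : α → ℝ} (ha : Tendsto a l (𝓝 0)) :
    Tendsto (fun x => ENNReal.ofReal (normMgf E (a x))) l (𝓝 1) := by
  have h : Continuous (mgf (fun y : E => ‖y‖) (stdGaussian E)) :=
    continuous_mgf fun a => integrable_exp_mul_norm_stdGaussian a
  have h0 : mgf (fun y : E => ‖y‖) (stdGaussian E) 0 = 1 := by simp
  have := ENNReal.tendsto_ofReal ((h.tendsto 0).comp ha)
  rw [h0, ENNReal.ofReal_one] at this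
  exact this

theorem heat_expFun_le_normMgf {φ : E → ℝ} {L : ℝ≥0} (hφ : LipschitzWith L φ) (t : ℝ) (x : E) :
    heat t (expFun φ) x ≤ ENNReal.ofReal (normMgf E (L * √t)) * expFun φ x := by
  rw [← hφ.expFun_logHeat, expFun, expFun, hφ.exp_logHeat, mul_comm,
    ← ENNReal.ofReal_mul (Real.exp_pos _).le, normMgf, ← integral_const_mul]
  refine ENNReal.ofReal_le_ofReal (integral_mono (hφ.integrable_exp_comp_stdGaussian x _)
    ((integrable_exp_mul_norm_stdGaussian _).const_mul _) fun y => ?_)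
  refine (hφ.exp_add_le x _).trans_eq ?_
  rw [norm_smul, Real.norm_eq_abs, abs_of_nonneg (Real.sqrt_nonneg _), mul_assoc]

theorem normMgf_le_heat_expFun {φ : E → ℝ} {L : ℝ≥0} (hφ : LipschitzWith L φ) (t : ℝ) (x : E) :
    ENNReal.ofReal (normMgf E (-L * √t)) * expFun φ x ≤ heat t (expFun φ) x := by
  rw [← hφ.expFun_logHeat, expFun, expFun, hφ.exp_logHeat, mul_comm,
    ← ENNReal.ofReal_mul (Real.exp_pos _).le, normMgf, ← integral_const_mul]
  refine ENNReal.ofReal_le_ofReal (integral_mono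
    ((integrable_exp_mul_norm_stdGaussian _).const_mul _)
    (hφ.integrable_exp_comp_stdGaussian x _) fun y => ?_)
  refine le_trans (le_of_eq ?_) (hφ.le_exp_add x _)
  simp only
  rw [norm_smul, Real.norm_eq_abs, abs_of_nonneg (Real.sqrt_nonneg _), mul_assoc]

namespace IsGeometricDatum

variable {ι : Type*} [Fintype ι] {F : ι → Type*} [∀ i, NormedAddCommGroup (F i)]
  [∀ i, InnerProductSpace ℝ (F i)] [∀ i, FiniteDimensional ℝ (F i)]
  {c : ι → ℝ} {J : (i : ι) → F i →ₗᵢ[ℝ] E}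
  [∀ i, MeasurableSpace (F i)] [∀ i, BorelSpace (F i)]

/-- `n` steps of length `t`, for functions mollified by `heat τ`: as the semigroup commutes with
itself, the functions stay of this form, and the constant `C` is the same at all steps. -/
theorem exists_prod_heat_nsmul_le (h : IsGeometricDatum c J) (L : ι → ℝ≥0) {τ : ℝ} (hτ : 0 < τ) :
    ∃ C : ℝ, ∀ n : ℕ, ∀ t : ℝ, 0 ≤ t → t ≤ 1 → ∀ ψ : (i : ι) → F i → ℝ,
      (∀ i, LipschitzWith (L i) (ψ i)) → ∀ g : E → ℝ≥0∞, Measurable g →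
      (∀ x : (i : ι) → F i, ∏ i, heat τ (expFun (ψ i)) (x i) ^ c i ≤ g (∑ i, c i • J i (x i))) →
      ∀ x : (i : ι) → F i, ∏ i, heat (n * t) (heat τ (expFun (ψ i))) (x i) ^ c i ≤
        ENNReal.ofReal (Real.exp (n * (C * t ^ 2))) *
          heat (n * t) g (∑ i, c i • J i (x i)) := by
  choose K hK using fun i => exists_hasUniformTaylor_logHeat (E := F i) (L i) hτ
  obtain ⟨C, hC⟩ := h.exists_prod_heat_le L K
  refine ⟨C, fun n t ht ht1 => ?_⟩
  induction n with
  | zero => intro ψ hψ g hg hle x; simpa [heat_zero] using hle x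
  | succ n ih =>
    intro ψ hψ g hg hle x
    have hm := fun i => measurable_expFun (hψ i)
    have hnt : (0 : ℝ) ≤ n * t := by positivity
    have hstep := hC (fun i => logHeat τ (ψ i)) (fun i => (hψ i).logHeat τ)
      (fun i => hK i _ (hψ i)) g (by simpa only [(hψ _).expFun_logHeat] using hle) t ht ht1
    have e : ∀ i, heat τ (expFun (logHeat t (ψ i))) = heat t (heat τ (expFun (ψ i))) := fun i => by
      rw [(hψ i).expFun_logHeat, heat_comm hτ.le ht (hm i)]
    have := ih (fun i => logHeat t (ψ i)) (fun i => (hψ i).logHeat t)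
      (fun z => ENNReal.ofReal (Real.exp (C * t ^ 2)) * heat t g z)
      ((measurable_heat hg).const_mul _)
      (by simpa only [e, fun i => (hψ i).expFun_logHeat τ] using hstep) x
    simp only [e, heat_const_mul (measurable_heat hg), heat_heat hnt ht hg] at this
    simp only [heat_heat hnt ht (measurable_heat (hm _)), ← mul_assoc] at this
    rw [← ENNReal.ofReal_mul (Real.exp_pos _).le, ← Real.exp_add] at this
    push_cast
    rwa [add_mul, one_mul, add_mul, one_mul, ← mul_assoc (n : ℝ)]

/-- The inequality at time `1` for mollified log-Lipschitz functions. -/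
theorem prod_heat_one_heat_le (h : IsGeometricDatum c J) {L : ι → ℝ≥0} {τ : ℝ} (hτ : 0 < τ)
    {ψ : (i : ι) → F i → ℝ} (hψ : ∀ i, LipschitzWith (L i) (ψ i)) {g : E → ℝ≥0∞}
    (hg : Measurable g)
    (hle : ∀ x : (i : ι) → F i,
      ∏ i, heat τ (expFun (ψ i)) (x i) ^ c i ≤ g (∑ i, c i • J i (x i))) (x : (i : ι) → F i) :
    ∏ i, heat 1 (heat τ (expFun (ψ i))) (x i) ^ c i ≤ heat 1 g (∑ i, c i • J i (x i)) := by
  obtain ⟨C, hC⟩ := h.exists_prod_heat_nsmul_le L hτ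
  -- `n + 1` steps of length `1 / (n + 1)`
  have key : ∀ n : ℕ, ∏ i, heat 1 (heat τ (expFun (ψ i))) (x i) ^ c i ≤
      ENNReal.ofReal (Real.exp (C * (1 / ((n : ℝ) + 1)))) *
        heat 1 g (∑ i, c i • J i (x i)) := by
    intro n
    have hn : (0 : ℝ) < (n : ℝ) + 1 := by positivity
    have := hC (n + 1) (1 / ((n : ℝ) + 1)) (by positivity)
      (by rw [div_le_one hn]; linarith [n.cast_nonneg (α := ℝ)]) ψ hψ g hg hle x
    push_cast at this
    rw [mul_one_div_cancel hn.ne'] at this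
    convert this using 4
    field_simp
  have hlim : Tendsto (fun n : ℕ => ENNReal.ofReal (Real.exp (C * (1 / ((n : ℝ) + 1)))) *
      heat 1 g (∑ i, c i • J i (x i))) atTop (𝓝 (1 * heat 1 g (∑ i, c i • J i (x i)))) := by
    refine ENNReal.Tendsto.mul_const ?_ (.inl one_ne_zero)
    have := ENNReal.tendsto_ofReal ((Real.continuous_exp.tendsto _).comp
      ((tendsto_one_div_add_atTop_nhds_zero_nat (𝕜 := ℝ)).const_mul C))
    simpa using this
  rw [one_mul] at hlim
  exact ge_of_tendsto' hlim key

/-- The inequality at time `1` for log-Lipschitz functions. The mollification by `heat τ` changes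
them by factors which tend to `1` as `τ → 0`. -/
theorem prod_heat_one_le (h : IsGeometricDatum c J) {L : ι → ℝ≥0}
    {ψ : (i : ι) → F i → ℝ} (hψ : ∀ i, LipschitzWith (L i) (ψ i)) {g : E → ℝ≥0∞}
    (hg : Measurable g)
    (hle : ∀ x : (i : ι) → F i, ∏ i, expFun (ψ i) (x i) ^ c i ≤ g (∑ i, c i • J i (x i)))
    (x : (i : ι) → F i) :
    ∏ i, heat 1 (expFun (ψ i)) (x i) ^ c i ≤ heat 1 g (∑ i, c i • J i (x i)) := by
  have hm := fun i => measurable_expFun (hψ i)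
  set ρ : ℝ → ℝ → ℝ≥0∞ := fun s τ =>
    ∏ i, ENNReal.ofReal (normMgf (F i) (s * L i * √τ)) ^ c i with hρ
  have hρlim : ∀ s, Tendsto (ρ s) (𝓝[>] 0) (𝓝 1) := by
    intro s
    have h1 : Tendsto (ρ s) (𝓝[>] 0) (𝓝 (∏ i : ι, (1 : ℝ≥0∞) ^ c i)) := by
      refine ENNReal.tendsto_finsetProd_of_ne_zero (fun i _ => ?_) (by simp)
      refine Tendsto.ennrpow_const _ (tendsto_normMgf ?_)
      have : Continuous fun τ : ℝ => s * L i * √τ := by fun_prop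
      have := this.tendsto 0
      simp only [Real.sqrt_zero, mul_zero] at this
      exact this.mono_left nhdsWithin_le_nhds
    simpa using h1
  have key : ∀ τ > 0, ρ (-1) τ * ∏ i, heat 1 (expFun (ψ i)) (x i) ^ c i ≤
      ρ 1 τ * heat 1 g (∑ i, c i • J i (x i)) := by
    intro τ hτ
    have h1 := h.prod_heat_one_heat_le hτ hψ (g := fun z => ρ 1 τ * g z) (hg.const_mul _) (by
      intro z
      refine le_trans ?_ (mul_le_mul_right (hle z) _)
      rw [hρ]
      simp only
      rw [← Finset.prod_mul_distrib]
      gcongr with i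
      rw [← ENNReal.mul_rpow_of_nonneg _ _ (h.pos i).le]
      gcongr
      · exact (h.pos i).le
      · rw [one_mul]; exact heat_expFun_le_normMgf (hψ i) τ (z i)) x
    rw [heat_const_mul hg] at h1
    refine le_trans ?_ h1
    rw [hρ]
    simp only
    rw [← Finset.prod_mul_distrib]
    gcongr with i
    rw [← ENNReal.mul_rpow_of_nonneg _ _ (h.pos i).le, heat_comm zero_le_one hτ.le (hm i),
      ← (hψ i).expFun_logHeat 1]
    gcongr
    · exact (h.pos i).le
    · rw [neg_one_mul]; exact normMgf_le_heat_expFun ((hψ i).logHeat 1) τ (x i)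
  have l1 := ENNReal.Tendsto.mul_const (b := ∏ i, heat 1 (expFun (ψ i)) (x i) ^ c i) (hρlim (-1))
    (.inl one_ne_zero)
  have l2 := ENNReal.Tendsto.mul_const (b := heat 1 g (∑ i, c i • J i (x i))) (hρlim 1)
    (.inl one_ne_zero)
  rw [one_mul] at l1 l2
  exact le_of_tendsto_of_tendsto l1 l2 (eventually_nhdsWithin_of_forall key)

end IsGeometricDatum

end GaussianInequality

/-! ### The Gaussian inequality for upper semicontinuous functions -/

section SupConvolution

open ProbabilityTheory Filter Topology
open scoped RealInnerProductSpace NNReal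

/-- The factors are assumed nonzero because of the discontinuity of the product at `0 * ∞`. -/
theorem ENNReal.prod_rpow_le_of_forall_lt {ι : Type*} [Fintype ι] {c : ι → ℝ} {a : ι → ℝ≥0∞}
    (ha : ∀ i, a i ≠ 0) (hc : ∀ i, 0 < c i) {D : ℝ≥0∞}
    (h : ∀ b : ι → ℝ≥0∞, (∀ i, b i < a i) → ∏ i, b i ^ c i ≤ D) : ∏ i, a i ^ c i ≤ D := by
  choose b _ hb hlim using fun i => exists_seq_strictMono_tendsto' (pos_iff_ne_zero.2 (ha i))
  have hlim' : Tendsto (fun n => ∏ i, b i n ^ c i) atTop (𝓝 (∏ i, a i ^ c i)) :=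
    ENNReal.tendsto_finsetProd_of_ne_zero (fun i _ => (hlim i).ennrpow_const _) fun i _ => by
      rw [Ne, ENNReal.rpow_eq_zero_iff_of_pos (hc i)]; exact ha i
  exact le_of_tendsto' hlim' fun n => h _ fun i => (hb i n).2

theorem ENNReal.prod_ofReal_rpow {ι : Type*} [Fintype ι] {c a : ι → ℝ} (ha : ∀ i, 0 ≤ a i)
    (hc : ∀ i, 0 < c i) :
    ∏ i, ENNReal.ofReal (a i) ^ c i = ENNReal.ofReal (∏ i, a i ^ c i) := by
  rw [ENNReal.ofReal_prod_of_nonneg fun i _ => Real.rpow_nonneg (ha i) _]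
  exact Finset.prod_congr rfl fun i _ => ENNReal.ofReal_rpow_of_nonneg (ha i) (hc i).le

section

variable {α E : Type*} [SeminormedAddCommGroup E]

/-- The multiplicative sup-convolution `z ↦ sup_j a j * exp (-k ‖z - p j‖)` of values `a j` placed
at the points `p j`: for bounded nonnegative `a`, not all zero, it is log-`k`-Lipschitz. -/
noncomputable def supConv (k : ℝ≥0) (a : α → ℝ) (p : α → E) (z : E) : ℝ :=
  ⨆ j, a j * Real.exp (-(k * ‖z - p j‖))

variable {k : ℝ≥0} {a : α → ℝ} {p : α → E} {M : ℝ}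

theorem mul_exp_neg_le_bound (ha : ∀ j, 0 ≤ a j) (hM : ∀ j, a j ≤ M) (z : E) (j : α) :
    a j * Real.exp (-(k * ‖z - p j‖)) ≤ M :=
  (mul_le_of_le_one_right (ha j) (Real.exp_le_one_iff.2 (by
    have : 0 ≤ k * ‖z - p j‖ := by positivity
    linarith))).trans (hM j)

theorem le_supConv (ha : ∀ j, 0 ≤ a j) (hM : ∀ j, a j ≤ M) (z : E) (j : α) :
    a j * Real.exp (-(k * ‖z - p j‖)) ≤ supConv k a p z :=
  le_ciSup (f := fun j => a j * Real.exp (-(k * ‖z - p j‖)))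
    ⟨M, by rintro _ ⟨j, rfl⟩; exact mul_exp_neg_le_bound ha hM z j⟩ j

theorem supConv_le [Nonempty α] (ha : ∀ j, 0 ≤ a j) (hM : ∀ j, a j ≤ M) (z : E) :
    supConv k a p z ≤ M :=
  ciSup_le fun j => mul_exp_neg_le_bound ha hM z j

theorem supConv_pos (ha : ∀ j, 0 ≤ a j) (hM : ∀ j, a j ≤ M) (hpos : ∃ j, 0 < a j) (z : E) :
    0 < supConv k a p z := by
  obtain ⟨j, hj⟩ := hpos
  exact lt_of_lt_of_le (by positivity) (le_supConv ha hM z j)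

theorem lipschitzWith_log_supConv (ha : ∀ j, 0 ≤ a j) (hM : ∀ j, a j ≤ M)
    (hpos : ∃ j, 0 < a j) : LipschitzWith k fun z => Real.log (supConv k a p z) := by
  have : Nonempty α := ⟨hpos.choose⟩
  refine LipschitzWith.of_le_add_mul k fun x y => ?_
  rw [← Real.exp_le_exp, Real.exp_add, Real.exp_log (supConv_pos ha hM hpos x),
    Real.exp_log (supConv_pos ha hM hpos y)]
  refine ciSup_le fun j => ?_
  have h1 := le_supConv (k := k) (p := p) ha hM y j
  have h2 : ‖y - p j‖ ≤ dist x y + ‖x - p j‖ := by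
    rw [dist_comm, dist_eq_norm]; simpa using norm_add_le (y - x) (x - p j)
  calc a j * Real.exp (-(k * ‖x - p j‖))
      ≤ a j * Real.exp (-(k * ‖y - p j‖) + k * dist x y) := by
        have := ha j
        have := mul_le_mul_of_nonneg_left h2 k.2
        gcongr
        simp only [NNReal.val_eq_coe] at this
        linarith
    _ = a j * Real.exp (-(k * ‖y - p j‖)) * Real.exp (k * dist x y) := by
        rw [Real.exp_add, mul_assoc]
    _ ≤ _ := by gcongr

theorem expFun_log_supConv (ha : ∀ j, 0 ≤ a j) (hM : ∀ j, a j ≤ M) (hpos : ∃ j, 0 < a j) :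
    expFun (fun z => Real.log (supConv k a p z)) = fun z => ENNReal.ofReal (supConv k a p z) := by
  ext z
  rw [expFun, Real.exp_log (supConv_pos ha hM hpos z)]

end

variable {ι : Type*} [Fintype ι] {F : ι → Type*} [∀ i, NormedAddCommGroup (F i)]
  {c : ι → ℝ}

/-- The pointwise limit, as `k → ∞`, of the sup-convolutions of `∏ f i (x i) ^ c i`: for upper
semicontinuous functions with compact support, the supremum is attained in the limit. -/
theorem iInf_supConv_le {E : Type*} [NormedAddCommGroup E] [∀ i, ProperSpace (F i)]
    (hc : ∀ i, 0 < c i) {f : (i : ι) → F i → ℝ≥0} (hf : ∀ i, UpperSemicontinuous (f i)) {R M : ℝ}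
    (hM : ∀ x : (i : ι) → F i, ∏ i, (f i (x i) : ℝ) ^ c i ≤ M)
    (hR : ∀ i x, R < ‖x‖ → f i x = 0)
    {p : ((i : ι) → F i) → E} (hp : Continuous p) {g : E → ℝ≥0∞}
    (hle : ∀ x : (i : ι) → F i, ∏ i, (f i (x i) : ℝ≥0∞) ^ c i ≤ g (p x)) (z : E) :
    ⨅ k : ℕ, ENNReal.ofReal (supConv (k : ℝ≥0) (fun x : (i : ι) → F i =>
      ∏ i, (f i (x i) : ℝ) ^ c i) p z) ≤ g z := by
  by_contra! hlt
  obtain ⟨b, hgb, hb⟩ := ENNReal.lt_iff_exists_nnreal_btwn.1 hlt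
  have hb0 : 0 < (b : ℝ) := by
    have := (zero_le).trans_lt hgb
    exact_mod_cast this
  have hk : ∀ k : ℕ, ∃ x : (i : ι) → F i,
      (b : ℝ) < (∏ i, (f i (x i) : ℝ) ^ c i) * Real.exp (-(k * ‖z - p x‖)) := by
    intro k
    have h1 := hb.trans_le (iInf_le _ k)
    rw [← ENNReal.ofReal_coe_nnreal, ENNReal.ofReal_lt_ofReal_iff_of_nonneg b.coe_nonneg] at h1
    obtain ⟨x, hx⟩ := exists_lt_of_lt_ciSup h1
    exact ⟨x, by simpa using hx⟩
  choose x hx using hk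
  have ha0 : ∀ y : (i : ι) → F i, 0 ≤ ∏ i, (f i (y i) : ℝ) ^ c i :=
    fun y => Finset.prod_nonneg fun i _ => by positivity
  have hexp : ∀ k, Real.exp (-(k * ‖z - p (x k)‖)) ≤ 1 := fun k =>
    Real.exp_le_one_iff.2 (neg_nonpos.2 (by positivity))
  have hax : ∀ k, (b : ℝ) < ∏ i, (f i (x k i) : ℝ) ^ c i := fun k =>
    (hx k).trans_le (mul_le_of_le_one_right (ha0 _) (hexp k))
  have hmem : ∀ k, x k ∈ Set.univ.pi fun i => Metric.closedBall (0 : F i) R := by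
    intro k i _
    rw [mem_closedBall_zero_iff]
    by_contra! hcon
    have h0 : ∏ i, (f i (x k i) : ℝ) ^ c i = 0 :=
      Finset.prod_eq_zero (Finset.mem_univ i) (by rw [hR i _ hcon]; simp [(hc i).ne'])
    have := hax k
    linarith
  obtain ⟨y, -, φ, hφ, hy⟩ := (isCompact_univ_pi fun i =>
    isCompact_closedBall (0 : F i) R).tendsto_subseq hmem
  have hM0 : 0 < M := hb0.trans ((hax 0).trans_le (hM _))
  -- the constraint holds in the limit
  have hpz : p y = z := by
    have h1 : Tendsto (fun n => p (x (φ n))) atTop (𝓝 (p y)) := (hp.tendsto y).comp hy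
    have h2 : Tendsto (fun n => p (x (φ n))) atTop (𝓝 z) := by
      rw [tendsto_iff_norm_sub_tendsto_zero]
      have h3 : Tendsto (fun n : ℕ => Real.log (M / b) / (φ n : ℝ)) atTop (𝓝 0) :=
        (tendsto_const_div_atTop_nhds_zero_nat _).comp hφ.tendsto_atTop
      refine squeeze_zero' (.of_forall fun n => norm_nonneg _) ?_ h3
      filter_upwards [eventually_gt_atTop 0] with n hn
      have hφn : (0 : ℝ) < φ n := by exact_mod_cast (hn.trans_le (hφ.id_le n))
      rw [le_div_iff₀ hφn, norm_sub_rev, mul_comm, Real.le_log_iff_exp_le (by positivity),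
        le_div_iff₀ hb0]
      have h4 := (hx (φ n)).trans_le (mul_le_mul_of_nonneg_right (hM _) (Real.exp_pos _).le)
      rw [Real.exp_neg, ← div_eq_mul_inv, lt_div_iff₀ (Real.exp_pos _)] at h4
      linarith
    exact tendsto_nhds_unique h1 h2
  have hby : (b : ℝ) ≤ ∏ i, (f i (y i) : ℝ) ^ c i := by
    have hcont : Continuous fun η : ℝ => ∏ i, ((f i (y i) : ℝ) + η) ^ c i :=
      continuous_finsetProd _ fun i _ =>
        (continuous_const.add continuous_id).rpow_const fun _ => .inr (hc i).le
    have hl := (hcont.tendsto 0).mono_left (nhdsWithin_le_nhds (s := Set.Ioi 0))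
    simp only [add_zero] at hl
    refine ge_of_tendsto hl (eventually_nhdsWithin_of_forall fun η hη => ?_)
    have hev : ∀ᶠ n in atTop, ∀ i, (f i (x (φ n) i) : ℝ) < f i (y i) + η := by
      rw [eventually_all]
      intro i
      have h5 : Tendsto (fun n => x (φ n) i) atTop (𝓝 (y i)) :=
        ((continuous_apply i).tendsto y).comp hy
      have hη' : (0 : ℝ) < η := hη
      filter_upwards [h5.eventually (hf i (y i) (f i (y i) + ⟨η, hη'.le⟩)
        (lt_add_of_pos_right _ (by exact_mod_cast hη')))] with n hn
      exact_mod_cast hn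
    obtain ⟨n, hn⟩ := hev.exists
    refine (hax (φ n)).le.trans (Finset.prod_le_prod (fun i _ => by positivity) fun i _ => ?_)
    exact Real.rpow_le_rpow (by positivity) (hn i).le (hc i).le
  have h6 := hle y
  rw [hpz] at h6
  simp only [← ENNReal.ofReal_coe_nnreal] at h6 hgb
  rw [ENNReal.prod_ofReal_rpow (fun i => (f i (y i)).coe_nonneg) hc] at h6
  exact absurd ((ENNReal.ofReal_le_ofReal hby).trans h6) (not_le.2 hgb)

namespace IsGeometricDatum

variable {E : Type*} [NormedAddCommGroup E] [InnerProductSpace ℝ E] [FiniteDimensional ℝ E]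
  [∀ i, InnerProductSpace ℝ (F i)] [∀ i, FiniteDimensional ℝ (F i)]
  {J : (i : ι) → F i →ₗᵢ[ℝ] E}

/-- Sup-convolution preserves the constraint, because `‖∑ cᵢ Jᵢ yᵢ‖ ≤ ∑ cᵢ ‖yᵢ‖`. -/
theorem prod_supConv_le (h : IsGeometricDatum c J) {f : (i : ι) → F i → ℝ≥0} {M : ι → ℝ≥0}
    (hM : ∀ i x, f i x ≤ M i) (hpos : ∀ i, ∃ x, 0 < f i x) (k : ℝ≥0) (x : (i : ι) → F i) :
    ∏ i, ENNReal.ofReal (supConv k (fun y => (f i y : ℝ)) id (x i)) ^ c i ≤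
      ENNReal.ofReal (supConv k (fun y : (i : ι) → F i => ∏ i, (f i (y i) : ℝ) ^ c i)
        (fun y => ∑ i, c i • J i (y i)) (∑ i, c i • J i (x i))) := by
  refine ENNReal.prod_rpow_le_of_forall_lt (fun i => ?_) h.pos fun b hb => ?_
  · exact (ENNReal.ofReal_pos.2 (supConv_pos (M := M i) (fun y => (f i y).2)
      (fun y => by exact_mod_cast hM i y)
      (by obtain ⟨y, hy⟩ := hpos i; exact ⟨y, by exact_mod_cast hy⟩) _)).ne'
  have hy : ∀ i, ∃ y, b i < ENNReal.ofReal ((f i y : ℝ) * Real.exp (-(k * ‖x i - y‖))) := by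
    intro i
    have h1 := hb i
    have hbt : b i ≠ ⊤ := ne_top_of_lt h1
    rw [ENNReal.lt_ofReal_iff_toReal_lt hbt] at h1
    have : Nonempty (F i) := ⟨0⟩
    obtain ⟨y, hy⟩ := exists_lt_of_lt_ciSup h1
    exact ⟨y, (ENNReal.lt_ofReal_iff_toReal_lt hbt).2 hy⟩
  choose y hy using hy
  calc ∏ i, b i ^ c i
      ≤ ∏ i, ENNReal.ofReal ((f i (y i) : ℝ) * Real.exp (-(k * ‖x i - y i‖))) ^ c i := by
        gcongr with i
        · exact (h.pos i).le
        · exact (hy i).le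
    _ = ENNReal.ofReal ((∏ i, (f i (y i) : ℝ) ^ c i) *
          Real.exp (-(k * ∑ i, c i * ‖x i - y i‖))) := by
        rw [ENNReal.prod_ofReal_rpow (fun i => by positivity) h.pos]
        congr 1
        rw [Finset.mul_sum, ← Finset.sum_neg_distrib, Real.exp_sum, ← Finset.prod_mul_distrib]
        refine Finset.prod_congr rfl fun i _ => ?_
        rw [Real.mul_rpow (by positivity) (by positivity), ← Real.exp_mul]
        congr 2; ring
    _ ≤ ENNReal.ofReal ((∏ i, (f i (y i) : ℝ) ^ c i) *
          Real.exp (-(k * ‖∑ i, c i • J i (x i) - ∑ i, c i • J i (y i)‖))) := by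
        refine ENNReal.ofReal_le_ofReal ?_
        have e : ∑ i, c i • J i (x i) - ∑ i, c i • J i (y i) =
            ∑ i, c i • J i (x i - y i) := by
          simp only [map_sub, smul_sub, Finset.sum_sub_distrib]
        have h2 := h.norm_sum_le fun i => x i - y i
        rw [e]
        gcongr
    _ ≤ _ := by
        refine ENNReal.ofReal_le_ofReal (le_supConv (M := ∏ i, (M i : ℝ) ^ c i)
          (a := fun y : (i : ι) → F i => ∏ i, (f i (y i) : ℝ) ^ c i)
          (p := fun y => ∑ i, c i • J i (y i)) (fun y => by positivity) (fun y => ?_) _ y)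
        gcongr with i
        · exact (h.pos i).le
        · exact hM i _

variable [MeasurableSpace E] [BorelSpace E] [∀ i, MeasurableSpace (F i)] [∀ i, BorelSpace (F i)]

/-- The reversed Brascamp–Lieb inequality for the standard Gaussian measures. -/
theorem prod_lintegral_stdGaussian_le (h : IsGeometricDatum c J) {f : (i : ι) → F i → ℝ≥0}
    (hf : ∀ i, UpperSemicontinuous (f i)) {M : ι → ℝ≥0} (hM : ∀ i x, f i x ≤ M i) {R : ℝ}
    (hR : ∀ i x, R < ‖x‖ → f i x = 0) {g : E → ℝ≥0∞}
    (hle : ∀ x : (i : ι) → F i, ∏ i, (f i (x i) : ℝ≥0∞) ^ c i ≤ g (∑ i, c i • J i (x i))) :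
    ∏ i, (∫⁻ x, f i x ∂stdGaussian (F i)) ^ c i ≤ ∫⁻ x, g x ∂stdGaussian E := by
  by_cases hpos : ∀ i, ∃ x, 0 < f i x
  swap
  · push Not at hpos
    obtain ⟨i, hi⟩ := hpos
    rw [Finset.prod_eq_zero (Finset.mem_univ i)]
    · exact zero_le
    · have : ∀ x, f i x = 0 := fun x => le_antisymm (hi x) zero_le
      simp [this, h.pos i]
  set p : ((i : ι) → F i) → E := fun y => ∑ i, c i • J i (y i) with hp
  set a : ((i : ι) → F i) → ℝ := fun y => ∏ i, (f i (y i) : ℝ) ^ c i with ha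
  set N : ℝ := ∏ i, (M i : ℝ) ^ c i with hN
  have haN : ∀ y, a y ≤ N := fun y => by
    simp only [ha, hN]
    gcongr with i
    · exact (h.pos i).le
    · exact hM i _
  have ha0 : ∀ y, 0 ≤ a y := fun y => Finset.prod_nonneg fun i _ => by positivity
  have hapos : ∃ y, 0 < a y := by
    choose y hy using hpos
    exact ⟨y, Finset.prod_pos fun i _ => Real.rpow_pos_of_pos (by exact_mod_cast hy i) _⟩
  have hpc : Continuous p := by
    refine continuous_finsetSum _ fun i _ => ?_
    exact ((J i).continuous.comp (continuous_apply i)).const_smul _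
  set H : ℕ → E → ℝ≥0∞ := fun k z => ENNReal.ofReal (supConv (k : ℝ≥0) a p z) with hH
  have hHm : ∀ k, Measurable (H k) := fun k => by
    have h1 := measurable_expFun (lipschitzWith_log_supConv (k := (k : ℝ≥0)) (p := p) ha0 haN hapos)
    rwa [expFun_log_supConv ha0 haN hapos] at h1
  have hHanti : Antitone H := by
    intro k l hkl z
    have : Nonempty ((i : ι) → F i) := ⟨0⟩
    refine ENNReal.ofReal_le_ofReal (ciSup_le fun y => le_trans ?_ (le_supConv ha0 haN z y))
    have := ha0 y
    gcongr
  have key : ∀ k : ℕ, ∏ i, (∫⁻ x, f i x ∂stdGaussian (F i)) ^ c i ≤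
      ∫⁻ x, H k x ∂stdGaussian E := by
    intro k
    have hM' : ∀ i x, (f i x : ℝ) ≤ M i := fun i x => by exact_mod_cast hM i x
    have hpos' : ∀ i, ∃ x, 0 < (f i x : ℝ) := fun i => by
      obtain ⟨y, hy⟩ := hpos i; exact ⟨y, by exact_mod_cast hy⟩
    have h0 : ∀ i x, 0 ≤ (f i x : ℝ) := fun i x => (f i x).2
    have h1 := h.prod_heat_one_le
      (ψ := fun i z => Real.log (supConv (k : ℝ≥0) (fun y => (f i y : ℝ)) id z))
      (fun i => lipschitzWith_log_supConv (h0 i) (hM' i) (hpos' i)) (hHm k) (by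
        intro x
        simp only [expFun_log_supConv (h0 _) (hM' _) (hpos' _)]
        exact h.prod_supConv_le hM hpos k x) 0
    simp only [heat, Pi.zero_apply, map_zero, smul_zero, Finset.sum_const_zero, Real.sqrt_one,
      one_smul, zero_add] at h1
    refine le_trans ?_ h1
    gcongr with i
    · exact (h.pos i).le
    rename_i x
    rw [expFun_log_supConv (h0 _) (hM' _) (hpos' _), ← ENNReal.ofReal_coe_nnreal]
    refine ENNReal.ofReal_le_ofReal ?_
    simpa using le_supConv (k := (k : ℝ≥0)) (p := id) (h0 i) (hM' i) x x
  refine (le_iInf key).trans ?_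
  rw [← lintegral_iInf hHm hHanti]
  · refine lintegral_mono fun z => ?_
    exact iInf_supConv_le h.pos hf haN hR hpc hle z
  · have : Nonempty ((i : ι) → F i) := ⟨0⟩
    refine ne_top_of_le_ne_top (b := ∫⁻ _, ENNReal.ofReal N ∂stdGaussian E) (by simp) ?_
    exact lintegral_mono fun z => ENNReal.ofReal_le_ofReal (supConv_le ha0 haN z)

end IsGeometricDatum

end SupConvolution

/-! ### The geometric reversed Brascamp–Lieb inequality for Lebesgue measure -/

section Lebesgue

open ProbabilityTheory Filter Topology
open scoped RealInnerProductSpace NNReal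

theorem UpperSemicontinuous.indicator_of_isClosed {X : Type*} [TopologicalSpace X] {u : X → ℝ≥0}
    (hu : UpperSemicontinuous u) {s : Set X} (hs : IsClosed s) :
    UpperSemicontinuous (s.indicator u) := by
  intro x y hy
  by_cases hx : x ∈ s
  · rw [Set.indicator_of_mem hx] at hy
    filter_upwards [hu x y hy] with z hz
    exact (Set.indicator_le_self s u z).trans_lt hz
  · rw [Set.indicator_of_notMem hx] at hy
    filter_upwards [hs.isOpen_compl.mem_nhds hx] with z hz
    rwa [Set.indicator_of_notMem hz]

theorem ENNReal.rpow_sum_of_nonneg {ι : Type*} {κ : ℝ≥0∞} {s : Finset ι} {a : ι → ℝ}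
    (ha : ∀ i ∈ s, 0 ≤ a i) : κ ^ ∑ i ∈ s, a i = ∏ i ∈ s, κ ^ a i := by
  classical
  induction s using Finset.induction_on with
  | empty => simp
  | insert i s his ih =>
    have hs : ∀ j ∈ s, 0 ≤ a j := fun j hj => ha j (by simp [hj])
    rw [Finset.sum_insert his, Finset.prod_insert his, ENNReal.rpow_add_of_nonneg _ _
      (ha i (by simp)) (Finset.sum_nonneg hs), ih hs]

theorem stdGaussian_density_eq {E : Type*} [SeminormedAddCommGroup E]
    [Module ℝ E] (x : E) :
    ENNReal.ofReal (((2 * Real.pi) ^ (Module.finrank ℝ E / 2 : ℝ))⁻¹ *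
      Real.exp (-‖x‖ ^ 2 / 2)) = ENNReal.ofReal (√(2 * Real.pi))⁻¹ ^ Module.finrank ℝ E *
        ENNReal.ofReal (Real.exp (-‖x‖ ^ 2 / 2)) := by
  rw [ENNReal.ofReal_mul (by positivity), ← ENNReal.ofReal_pow (by positivity), inv_pow]
  congr 3
  rw [Real.sqrt_eq_rpow, ← Real.rpow_natCast, ← Real.rpow_mul (by positivity)]
  congr 1; ring

section

variable {E : Type*} [NormedAddCommGroup E] [MeasurableSpace E] [BorelSpace E]

/-- The integral of a nonnegative function is approximated from below by bounded upper
semicontinuous functions vanishing outside of a ball. -/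
theorem exists_upperSemicontinuous_lt_lintegral {μ : Measure E} [SigmaFinite μ] [μ.WeaklyRegular]
    {f : E → ℝ≥0} {b : ℝ≥0∞} (hb : b < ∫⁻ x, f x ∂μ) :
    ∃ u : E → ℝ≥0, UpperSemicontinuous u ∧ (∀ x, u x ≤ f x) ∧ (∃ M, ∀ x, u x ≤ M) ∧
      (∃ R : ℝ, ∀ x, R < ‖x‖ → u x = 0) ∧ b < ∫⁻ x, u x ∂μ := by
  obtain ⟨s, hsf, hs, hbs⟩ := exists_lt_lintegral_simpleFunc_of_lt_lintegral hb
  obtain ⟨ε, hε, hbε⟩ := ENNReal.lt_iff_exists_add_pos_lt.1 hbs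
  obtain ⟨u, hus, husc, hu⟩ := s.exists_upperSemicontinuous_le_lintegral_le hs.ne
    (ε := ε) (by exact_mod_cast hε.ne')
  have hbu : b < ∫⁻ x, u x ∂μ := lt_of_add_lt_add_right (hbε.trans_le hu)
  obtain ⟨M, hM⟩ := s.exists_forall_le
  have hum : Measurable u := husc.measurable
  have hsup : ∫⁻ x, u x ∂μ =
      ⨆ n : ℕ, ∫⁻ x, ((Metric.closedBall (0 : E) n).indicator u x : ℝ≥0) ∂μ := by
    rw [← lintegral_iSup]
    · refine lintegral_congr fun x => le_antisymm ?_ (iSup_le fun n => ?_)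
      · obtain ⟨n, hn⟩ := exists_nat_ge ‖x‖
        refine le_iSup_of_le n ?_
        rw [Set.indicator_of_mem (by simpa using hn)]
      · exact_mod_cast Set.indicator_le_self _ _ x
    · intro n
      exact (hum.indicator Metric.isClosed_closedBall.measurableSet).coe_nnreal_ennreal
    · intro n m hnm x
      simp only
      rw [ENNReal.coe_le_coe]
      refine Set.indicator_le_indicator_of_subset (Metric.closedBall_subset_closedBall ?_)
        (fun _ => zero_le) x
      exact_mod_cast hnm
  rw [hsup, lt_iSup_iff] at hbu
  obtain ⟨n, hn⟩ := hbu
  refine ⟨_, husc.indicator_of_isClosed Metric.isClosed_closedBall, fun x => ?_, ⟨M, fun x => ?_⟩,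
    ⟨n, fun x hx => ?_⟩, hn⟩
  · exact (Set.indicator_le_self _ u x).trans ((hus x).trans (hsf x))
  · exact (Set.indicator_le_self _ u x).trans ((hus x).trans (hM x))
  · exact Set.indicator_of_notMem (by simpa using hx) _

end

section

variable {E : Type*} [NormedAddCommGroup E] [InnerProductSpace ℝ E] [FiniteDimensional ℝ E]
  [MeasurableSpace E] [BorelSpace E]

theorem lintegral_comp_smul {s : ℝ} (hs : 0 < s) (f : E → ℝ≥0∞) :
    ∫⁻ x : E, f (s • x) = ENNReal.ofReal s⁻¹ ^ Module.finrank ℝ E * ∫⁻ x, f x := by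
  have he : MeasurableEmbedding (fun x : E => s • x) :=
    (Homeomorph.smulOfNeZero s hs.ne').measurableEmbedding
  rw [← he.lintegral_map, Measure.map_addHaar_smul _ hs.ne', lintegral_smul_measure,
    abs_of_pos (by positivity), ← ENNReal.ofReal_pow (by positivity), inv_pow, smul_eq_mul]

theorem lintegral_stdGaussian_comp_smul_le {s : ℝ} (hs : 0 < s) (g : E → ℝ≥0∞) :
    ∫⁻ x, g (s • x) ∂stdGaussian E ≤
      ENNReal.ofReal ((√(2 * Real.pi))⁻¹ * s⁻¹) ^ Module.finrank ℝ E * ∫⁻ x, g x := by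
  rw [stdGaussian_eq_withDensity]
  refine (lintegral_withDensity_le_lintegral_mul _ (by fun_prop) _).trans ?_
  calc _ ≤ ∫⁻ x : E, ENNReal.ofReal (√(2 * Real.pi))⁻¹ ^ Module.finrank ℝ E * g (s • x) := by
        refine lintegral_mono fun x => ?_
        simp only [Pi.mul_apply]
        rw [stdGaussian_density_eq]
        refine mul_le_mul_left (mul_le_of_le_one_right zero_le ?_) _
        rw [ENNReal.ofReal_le_one, Real.exp_le_one_iff]
        have := sq_nonneg ‖x‖
        linarith
    _ = _ := by
        rw [lintegral_const_mul' _ _ (ENNReal.pow_ne_top ENNReal.ofReal_ne_top),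
          lintegral_comp_smul hs, ← mul_assoc, ← mul_pow,
          ENNReal.ofReal_mul (by positivity)]

theorem le_lintegral_stdGaussian_comp_smul {s : ℝ} (hs : 0 < s) {f : E → ℝ≥0} (hf : Measurable f)
    {R : ℝ} (hR : ∀ x, R < ‖x‖ → f x = 0) :
    ENNReal.ofReal (Real.exp (-(R / s) ^ 2 / 2)) *
      (ENNReal.ofReal ((√(2 * Real.pi))⁻¹ * s⁻¹) ^ Module.finrank ℝ E * ∫⁻ x, f x) ≤
      ∫⁻ x, f (s • x) ∂stdGaussian E := by
  rw [stdGaussian_eq_withDensity, lintegral_withDensity_eq_lintegral_mul _ (by fun_prop)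
    (by fun_prop), ENNReal.ofReal_mul (by positivity), mul_pow, mul_assoc,
    ← lintegral_comp_smul hs (fun x => (f x : ℝ≥0∞)),
    ← lintegral_const_mul' _ _ (ENNReal.pow_ne_top ENNReal.ofReal_ne_top),
    ← lintegral_const_mul' _ _ ENNReal.ofReal_ne_top]
  refine lintegral_mono fun x => ?_
  simp only [Pi.mul_apply]
  rw [stdGaussian_density_eq]
  rcases lt_or_ge R ‖s • x‖ with hx | hx
  · simp [hR _ hx]
  · rw [← mul_assoc, mul_comm (ENNReal.ofReal (Real.exp _))]
    gcongr
    rw [norm_smul, Real.norm_eq_abs, abs_of_pos hs] at hx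
    rw [le_div_iff₀ hs]
    linarith

end

variable {E : Type*} [NormedAddCommGroup E] [InnerProductSpace ℝ E] [FiniteDimensional ℝ E]
  {ι : Type*} [Fintype ι] {F : ι → Type*} [∀ i, NormedAddCommGroup (F i)]
  [∀ i, InnerProductSpace ℝ (F i)] [∀ i, FiniteDimensional ℝ (F i)]
  {c : ι → ℝ} {J : (i : ι) → F i →ₗᵢ[ℝ] E}

namespace IsGeometricDatum

/-- The trace of the frame identity. -/
theorem sum_mul_finrank (h : IsGeometricDatum c J) :
    ∑ i, c i * (Module.finrank ℝ (F i) : ℝ) = Module.finrank ℝ E := by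
  set B := fun i => (ContinuousLinearMap.adjoint (J i).toContinuousLinearMap : E →ₗ[ℝ] F i) with hB
  have h1 : ∑ i, c i • ((J i).toLinearMap ∘ₗ B i) = LinearMap.id := by
    ext x
    simpa [hB] using h.frame x
  have h2 : ∀ i, B i ∘ₗ (J i).toLinearMap = LinearMap.id := by
    intro i
    ext x
    refine ext_inner_right ℝ fun y => ?_
    simp only [hB, LinearMap.comp_apply, ContinuousLinearMap.coe_coe,
      ContinuousLinearMap.adjoint_inner_left, LinearMap.id_apply]
    exact (J i).inner_map_map x y
  have h3 := congrArg (LinearMap.trace ℝ E) h1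
  rw [LinearMap.trace_id, map_sum] at h3
  rw [← h3]
  refine Finset.sum_congr rfl fun i _ => ?_
  rw [map_smul, LinearMap.trace_comp_comm', h2, LinearMap.trace_id, smul_eq_mul]

variable [MeasurableSpace E] [BorelSpace E] [∀ i, MeasurableSpace (F i)] [∀ i, BorelSpace (F i)]

/-- The Gaussian inequality for the functions `x ↦ f i (s x)`, as `s → ∞`: on the bounded supports
the Gaussian densities become constant. -/
theorem prod_lintegral_le_of_upperSemicontinuous (h : IsGeometricDatum c J)
    {f : (i : ι) → F i → ℝ≥0} (hf : ∀ i, UpperSemicontinuous (f i)) {M : ι → ℝ≥0}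
    (hM : ∀ i x, f i x ≤ M i) {R : ι → ℝ} (hR : ∀ i x, R i < ‖x‖ → f i x = 0) {g : E → ℝ≥0∞}
    (hle : ∀ x : (i : ι) → F i, ∏ i, (f i (x i) : ℝ≥0∞) ^ c i ≤ g (∑ i, c i • J i (x i))) :
    ∏ i, (∫⁻ x, f i x) ^ c i ≤ ∫⁻ x, g x := by
  obtain ⟨R', hR'⟩ : ∃ R' : ℝ, ∀ i, R i ≤ R' := by
    obtain ⟨R', h'⟩ := (Set.finite_range R).bddAbove
    exact ⟨R', fun i => h' ⟨i, rfl⟩⟩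
  have hR2 : ∀ i x, R' < ‖x‖ → f i x = 0 := fun i x hx => hR i x ((hR' i).trans_lt hx)
  have key : ∀ s : ℝ, 0 < s → (∏ i, ENNReal.ofReal (Real.exp (-(R' / s) ^ 2 / 2)) ^ c i) *
      ∏ i, (∫⁻ x, f i x) ^ c i ≤ ∫⁻ x, g x := by
    intro s hs
    set κ := ENNReal.ofReal ((√(2 * Real.pi))⁻¹ * s⁻¹) with hκ
    have hκ0 : κ ≠ 0 := by
      rw [hκ, Ne, ENNReal.ofReal_eq_zero, not_le]
      positivity
    have hκt : κ ≠ ⊤ := ENNReal.ofReal_ne_top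
    have h1 := h.prod_lintegral_stdGaussian_le (f := fun i x => f i (s • x))
      (g := fun x => g (s • x)) (fun i => (hf i).comp (continuous_const_smul s))
      (fun i x => hM i _) (R := R' / s) (fun i x hx => hR2 i _ (by
        rw [norm_smul, Real.norm_eq_abs, abs_of_pos hs]
        rw [div_lt_iff₀ hs] at hx
        linarith)) (by
        intro x
        have := hle fun i => s • x i
        simpa only [map_smul, Finset.smul_sum, smul_comm s] using this)
    have h2 := h1.trans (lintegral_stdGaussian_comp_smul_le hs g)
    have h3 : κ ^ Module.finrank ℝ E *
        ((∏ i, ENNReal.ofReal (Real.exp (-(R' / s) ^ 2 / 2)) ^ c i) * ∏ i, (∫⁻ x, f i x) ^ c i) ≤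
        κ ^ Module.finrank ℝ E * ∫⁻ x, g x := by
      refine le_trans ?_ h2
      have e : κ ^ Module.finrank ℝ E = ∏ i, (κ ^ Module.finrank ℝ (F i)) ^ c i := by
        rw [← ENNReal.rpow_natCast, ← h.sum_mul_finrank, ENNReal.rpow_sum_of_nonneg
          fun i _ => mul_nonneg (h.pos i).le (Nat.cast_nonneg _)]
        refine Finset.prod_congr rfl fun i _ => ?_
        rw [mul_comm, ENNReal.rpow_mul, ENNReal.rpow_natCast]
      rw [e, ← Finset.prod_mul_distrib, ← Finset.prod_mul_distrib]
      gcongr with i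
      rw [← ENNReal.mul_rpow_of_nonneg _ _ (h.pos i).le,
        ← ENNReal.mul_rpow_of_nonneg _ _ (h.pos i).le, mul_left_comm]
      gcongr
      · exact (h.pos i).le
      · exact le_lintegral_stdGaussian_comp_smul hs (hf i).measurable (hR2 i)
    refine (ENNReal.mul_le_mul_iff_right (pow_ne_zero _ hκ0) (ENNReal.pow_ne_top hκt)).1 h3
  have hlim : Tendsto (fun s : ℝ => ∏ i, ENNReal.ofReal (Real.exp (-(R' / s) ^ 2 / 2)) ^ c i) atTop
      (𝓝 (∏ i : ι, (1 : ℝ≥0∞) ^ c i)) := by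
    refine ENNReal.tendsto_finsetProd_of_ne_zero (fun i _ => ?_) (by simp)
    refine Tendsto.ennrpow_const _ ?_
    have h4 : Tendsto (fun s : ℝ => R' / s) atTop (𝓝 0) := tendsto_const_nhds.div_atTop tendsto_id
    have h5 : Continuous fun r : ℝ => Real.exp (-r ^ 2 / 2) := by fun_prop
    simpa using ENNReal.tendsto_ofReal ((h5.tendsto 0).comp h4)
  simp only [ENNReal.one_rpow, Finset.prod_const_one] at hlim
  have hlim2 := ENNReal.Tendsto.mul_const (b := ∏ i, (∫⁻ x, f i x) ^ c i) hlim (.inl one_ne_zero)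
  rw [one_mul] at hlim2
  exact le_of_tendsto hlim2 ((eventually_gt_atTop 0).mono key)

/-- The reversed Brascamp–Lieb inequality for a geometric datum, with constant `1`. -/
theorem prod_lintegral_le (h : IsGeometricDatum c J) {f : (i : ι) → F i → ℝ≥0} {g : E → ℝ≥0∞}
    (hle : ∀ x : (i : ι) → F i, ∏ i, (f i (x i) : ℝ≥0∞) ^ c i ≤ g (∑ i, c i • J i (x i))) :
    ∏ i, (∫⁻ x, f i x) ^ c i ≤ ∫⁻ x, g x := by
  by_cases h0 : ∀ i, ∫⁻ x, f i x ≠ 0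
  swap
  · push Not at h0
    obtain ⟨i, hi⟩ := h0
    rw [Finset.prod_eq_zero (Finset.mem_univ i)]
    · exact zero_le
    · simp [hi, h.pos i]
  refine ENNReal.prod_rpow_le_of_forall_lt h0 h.pos fun b hb => ?_
  choose u husc huf hM hR hbu using fun i => exists_upperSemicontinuous_lt_lintegral (hb i)
  choose M hM using hM
  choose R hR using hR
  have h1 := h.prod_lintegral_le_of_upperSemicontinuous husc hM hR (g := g) fun x => by
    refine le_trans ?_ (hle x)
    gcongr with i
    · exact (h.pos i).le
    · exact huf i _
  refine le_trans ?_ h1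
  gcongr with i
  · exact (h.pos i).le
  · exact (hbu i).le

end IsGeometricDatum

end Lebesgue

/-! ### Reduction to a geometric datum -/

section Normalization

open ProbabilityTheory Filter Topology
open scoped RealInnerProductSpace NNReal MatrixOrder

namespace Matrix

theorem PosDef.exists_eq_mul_transpose {k : ℕ} {M : Matrix (Fin k) (Fin k) ℝ} (hM : M.PosDef) :
    ∃ S : Matrix (Fin k) (Fin k) ℝ, S * Sᵀ = M ∧ IsUnit S.det := by
  obtain ⟨y, hy⟩ := CStarAlgebra.nonneg_iff_eq_star_mul_self.mp hM.posSemidef.nonneg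
  refine ⟨yᵀ, ?_, ?_⟩
  · rw [hy, star_eq_conjTranspose, conjTranspose_eq_transpose_of_trivial, transpose_transpose]
  · have h := hM.det_pos.ne'
    rw [hy, det_mul] at h
    rw [det_transpose]
    exact isUnit_iff_ne_zero.2 (right_ne_zero_of_mul h)

/-- A matrix with orthonormal columns, as a linear isometry of Euclidean spaces. -/
noncomputable def toEuclideanIsometry {k n : ℕ} (Q : Matrix (Fin n) (Fin k) ℝ) (hQ : Qᵀ * Q = 1) :
    EuclideanSpace ℝ (Fin k) →ₗᵢ[ℝ] EuclideanSpace ℝ (Fin n) where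
  toLinearMap := toEuclideanLin Q
  norm_map' x := by
    rw [← sq_eq_sq₀ (norm_nonneg _) (norm_nonneg _), ← real_inner_self_eq_norm_sq,
      ← real_inner_self_eq_norm_sq, EuclideanSpace.inner_eq_star_dotProduct,
      EuclideanSpace.inner_eq_star_dotProduct]
    simp only [ofLp_toLpLin, toLin'_apply, star_trivial]
    rw [dotProduct_mulVec, ← mulVec_transpose, mulVec_mulVec, hQ, one_mulVec]

theorem ofLp_toEuclideanIsometry {k n : ℕ} {Q : Matrix (Fin n) (Fin k) ℝ} (hQ : Qᵀ * Q = 1)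
    (x : EuclideanSpace ℝ (Fin k)) : (Q.toEuclideanIsometry hQ x).ofLp = Q *ᵥ x.ofLp := rfl

theorem ofLp_adjoint_toEuclideanIsometry {k n : ℕ} {Q : Matrix (Fin n) (Fin k) ℝ}
    (hQ : Qᵀ * Q = 1) (x : EuclideanSpace ℝ (Fin n)) :
    (ContinuousLinearMap.adjoint (Q.toEuclideanIsometry hQ).toContinuousLinearMap x).ofLp =
      Qᵀ *ᵥ x.ofLp := by
  have h : ContinuousLinearMap.adjoint (Q.toEuclideanIsometry hQ).toContinuousLinearMap x =
      WithLp.toLp 2 (Qᵀ *ᵥ x.ofLp) := by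
    refine ext_inner_right ℝ fun y => ?_
    rw [ContinuousLinearMap.adjoint_inner_left, EuclideanSpace.inner_eq_star_dotProduct,
      EuclideanSpace.inner_eq_star_dotProduct]
    change (Q *ᵥ y.ofLp) ⬝ᵥ star x.ofLp = y.ofLp ⬝ᵥ star (Qᵀ *ᵥ x.ofLp)
    rw [star_trivial, star_trivial, mulVec_transpose, dotProduct_comm, dotProduct_mulVec,
      dotProduct_comm]
  rw [h]

end Matrix

theorem isGeometricDatum_toEuclideanIsometry {m n : ℕ} {d : Fin m → ℕ} {c : Fin m → ℝ}
    (hc : ∀ i, 0 < c i) {Q : (i : Fin m) → Matrix (Fin n) (Fin (d i)) ℝ}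
    (hQ : ∀ i, (Q i)ᵀ * Q i = 1) (hsum : ∑ i, c i • (Q i * (Q i)ᵀ) = 1) :
    IsGeometricDatum c fun i => (Q i).toEuclideanIsometry (hQ i) where
  pos := hc
  frame x := by
    apply WithLp.ofLp_injective 2
    rw [WithLp.ofLp_sum]
    simp only [WithLp.ofLp_smul, Matrix.ofLp_toEuclideanIsometry,
      Matrix.ofLp_adjoint_toEuclideanIsometry, Matrix.mulVec_mulVec]
    have := congrArg (· *ᵥ x.ofLp) hsum
    simpa only [Matrix.sum_mulVec, Matrix.smul_mulVec, Matrix.one_mulVec] using this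

theorem IsBrascampLiebDatum.posDef {m n : ℕ} {d : Fin m → ℕ} {c : Fin m → ℝ}
    {B : (i : Fin m) → Matrix (Fin (d i)) (Fin n) ℝ} (hcB : IsBrascampLiebDatum c B)
    {A : Matrix (Fin n) (Fin n) ℝ} (hA : A.PosDef) (i : Fin m) :
    (B i * A * (B i)ᵀ).PosDef := by
  rw [← Matrix.conjTranspose_eq_transpose_of_trivial]
  refine hA.mul_mul_conjTranspose_same ?_
  obtain ⟨C, hC⟩ := Matrix.mulVec_surjective_iff_exists_right_inverse.1 (hcB.onto i)
  intro v w hvw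
  have := congrArg (Matrix.vecMul · C) hvw
  simpa only [Matrix.vecMul_vecMul, hC, Matrix.vecMul_one] using this

/-- Writing `A = S Sᵀ` and `B i A (B i)ᵀ = T i (T i)ᵀ`, the matrices `(T i)⁻¹ B i S` are the
adjoints of the isometries of a geometric datum. -/
theorem exists_normalization {m n : ℕ} {d : Fin m → ℕ} {c : Fin m → ℝ}
    {B : (i : Fin m) → Matrix (Fin (d i)) (Fin n) ℝ} (hcB : IsBrascampLiebDatum c B)
    {A : Matrix (Fin n) (Fin n) ℝ} (hA : A.PosDef)
    (hAB : A⁻¹ = ∑ i, c i • ((B i)ᵀ * (B i * A * (B i)ᵀ)⁻¹ * B i)) :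
    ∃ (S : Matrix (Fin n) (Fin n) ℝ) (T : (i : Fin m) → Matrix (Fin (d i)) (Fin (d i)) ℝ)
      (J : (i : Fin m) → EuclideanSpace ℝ (Fin (d i)) →ₗᵢ[ℝ] EuclideanSpace ℝ (Fin n)),
      S * Sᵀ = A ∧ IsUnit S.det ∧ (∀ i, T i * (T i)ᵀ = B i * A * (B i)ᵀ) ∧
      (∀ i, IsUnit (T i).det) ∧ IsGeometricDatum c J ∧
      ∀ i x, (J i x).ofLp = (Sᵀ * (B i)ᵀ * ((T i)ᵀ)⁻¹) *ᵥ x.ofLp := by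
  obtain ⟨S, hS, hSu⟩ := hA.exists_eq_mul_transpose
  choose T hT hTu using fun i => (hcB.posDef hA i).exists_eq_mul_transpose
  have hTu' : ∀ i, IsUnit ((T i)ᵀ).det := fun i => by rw [Matrix.det_transpose]; exact hTu i
  have hSu' : IsUnit (Sᵀ).det := by rw [Matrix.det_transpose]; exact hSu
  set Q := fun i => Sᵀ * (B i)ᵀ * ((T i)ᵀ)⁻¹ with hQdef
  have hQt : ∀ i, (Q i)ᵀ = (T i)⁻¹ * B i * S := fun i => by
    simp only [hQdef, Matrix.transpose_mul, Matrix.transpose_transpose,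
      ← Matrix.transpose_nonsing_inv,
      Matrix.mul_assoc]
  have hQ : ∀ i, (Q i)ᵀ * Q i = 1 := fun i => by
    rw [hQt]
    calc (T i)⁻¹ * B i * S * (Sᵀ * (B i)ᵀ * ((T i)ᵀ)⁻¹)
        = (T i)⁻¹ * (B i * (S * Sᵀ) * (B i)ᵀ) * ((T i)ᵀ)⁻¹ := by simp only [Matrix.mul_assoc]
      _ = (T i)⁻¹ * T i * ((T i)ᵀ * ((T i)ᵀ)⁻¹) := by rw [hS, ← hT]; simp only [Matrix.mul_assoc]
      _ = 1 := by
        rw [Matrix.nonsing_inv_mul _ (hTu i), Matrix.mul_nonsing_inv _ (hTu' i), Matrix.one_mul]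
  have hsum : ∑ i, c i • (Q i * (Q i)ᵀ) = 1 := by
    have e : ∀ i, Q i * (Q i)ᵀ = Sᵀ * ((B i)ᵀ * (B i * A * (B i)ᵀ)⁻¹ * B i) * S := fun i => by
      rw [hQt, ← hT, Matrix.mul_inv_rev]
      simp only [hQdef, Matrix.mul_assoc]
    have e2 : ∑ i, c i • (Q i * (Q i)ᵀ) = Sᵀ * A⁻¹ * S := by
      simp only [e, hAB, Matrix.mul_sum, Matrix.sum_mul, Matrix.mul_smul, Matrix.smul_mul]
    rw [e2, ← hS, Matrix.mul_inv_rev, ← Matrix.mul_assoc,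
      Matrix.mul_nonsing_inv _ hSu', Matrix.one_mul, Matrix.nonsing_inv_mul _ hSu]
  exact ⟨S, T, _, hS, hSu, hT, hTu, isGeometricDatum_toEuclideanIsometry hcB.pos hQ hsum,
    fun i x => rfl⟩

/-- Change of variables by an invertible matrix, from coordinate space to Euclidean space. -/
theorem lintegral_comp_mulVec {k : ℕ} {S : Matrix (Fin k) (Fin k) ℝ} (hS : IsUnit S.det)
    (f : (Fin k → ℝ) → ℝ≥0∞) :
    ∫⁻ x : EuclideanSpace ℝ (Fin k), f (S *ᵥ x.ofLp) =
      ENNReal.ofReal |S.det|⁻¹ * ∫⁻ x, f x := by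
  have he : MeasurableEmbedding (fun x : Fin k → ℝ => S *ᵥ x) := by
    have := (LinearMap.continuous_of_finiteDimensional (Matrix.toLin' S)).measurableEmbedding
      (Matrix.mulVec_injective_iff_isUnit.2 ((Matrix.isUnit_iff_isUnit_det S).2 hS))
    exact this
  rw [(PiLp.volume_preserving_ofLp (Fin k)).lintegral_comp_emb
    (MeasurableEquiv.toLp 2 (Fin k → ℝ)).symm.measurableEmbedding fun x => f (S *ᵥ x),
    ← he.lintegral_map, ← abs_inv, ← smul_eq_mul, ← lintegral_smul_measure,
    ← Real.map_matrix_volume_pi_eq_smul_volume_pi hS.ne_zero]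
  rfl

theorem integral_comp_mulVec {k : ℕ} {S : Matrix (Fin k) (Fin k) ℝ} (hS : IsUnit S.det)
    (f : (Fin k → ℝ) → ℝ) :
    ∫ x, f (S *ᵥ x) = |S.det|⁻¹ * ∫ x : EuclideanSpace ℝ (Fin k), f x.ofLp := by
  have he : MeasurableEmbedding (fun x : Fin k → ℝ => S *ᵥ x) := by
    have := (LinearMap.continuous_of_finiteDimensional (Matrix.toLin' S)).measurableEmbedding
      (Matrix.mulVec_injective_iff_isUnit.2 ((Matrix.isUnit_iff_isUnit_det S).2 hS))
    exact this
  have h : ∫ x, f x ∂(volume.map fun x : Fin k → ℝ => S *ᵥ x) = |S.det|⁻¹ * ∫ x, f x := by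
    have := Real.map_matrix_volume_pi_eq_smul_volume_pi hS.ne_zero
    change Measure.map (fun x : Fin k → ℝ => S *ᵥ x) volume = _ at this
    rw [this, integral_smul_measure, ENNReal.toReal_ofReal (abs_nonneg _), abs_inv, smul_eq_mul]
  rw [← he.integral_map, h, ← (PiLp.volume_preserving_ofLp (Fin k)).integral_comp
    (MeasurableEquiv.toLp 2 (Fin k → ℝ)).symm.measurableEmbedding]

theorem gaussianFun_mul_transpose {k : ℕ} (S : Matrix (Fin k) (Fin k) ℝ) (x : Fin k → ℝ) :
    gaussianFun (S * Sᵀ) x = Real.exp (-‖WithLp.toLp 2 (Sᵀ *ᵥ x)‖ ^ 2 / 2) := by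
  rw [gaussianFun, ← real_inner_self_eq_norm_sq, EuclideanSpace.inner_eq_star_dotProduct,
    star_trivial]
  congr 3
  rw [← Matrix.mulVec_mulVec, dotProduct_comm, Matrix.dotProduct_mulVec, ← Matrix.mulVec_transpose]

theorem integral_gaussianFun {k : ℕ} {S : Matrix (Fin k) (Fin k) ℝ} (hS : IsUnit S.det) :
    ∫ x, gaussianFun (S * Sᵀ) x = |S.det|⁻¹ * √(2 * Real.pi) ^ k := by
  simp only [gaussianFun_mul_transpose]
  rw [integral_comp_mulVec (S := Sᵀ) (by rwa [Matrix.det_transpose])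
    (fun x => Real.exp (-‖WithLp.toLp 2 x‖ ^ 2 / 2)), Matrix.det_transpose]
  congr 1
  have h := GaussianFourier.integral_rexp_neg_mul_sq_norm (V := EuclideanSpace ℝ (Fin k))
    (b := 1 / 2) (by norm_num)
  rw [finrank_euclideanSpace_fin] at h
  calc _ = ∫ v : EuclideanSpace ℝ (Fin k), Real.exp (-(1 / 2) * ‖v‖ ^ 2) := by
        congr 1; ext v; congr 1; simp only [WithLp.toLp_ofLp]; ring
    _ = _ := by
        rw [h, Real.sqrt_eq_rpow, ← Real.rpow_natCast, ← Real.rpow_mul (by positivity)]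
        congr 1 <;> ring

theorem integral_gaussianFun_pos {k : ℕ} {M : Matrix (Fin k) (Fin k) ℝ} (hM : M.PosDef) :
    0 < ∫ x, gaussianFun M x := by
  obtain ⟨S, rfl, hS⟩ := hM.exists_eq_mul_transpose
  rw [integral_gaussianFun hS]
  have := hS.ne_zero
  positivity

/-- The integral is nonzero, and a non-integrable function has integral `0` by convention. -/
theorem integrable_gaussianFun {k : ℕ} {M : Matrix (Fin k) (Fin k) ℝ} (hM : M.PosDef) :
    Integrable (gaussianFun M) :=
  not_imp_comm.1 integral_undef (integral_gaussianFun_pos hM).ne'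

theorem measurable_gaussianFun {k : ℕ} (M : Matrix (Fin k) (Fin k) ℝ) :
    Measurable (gaussianFun M) := by
  unfold gaussianFun
  have : Continuous fun x : Fin k → ℝ => (M *ᵥ x) ⬝ᵥ x := by fun_prop
  fun_prop

end Normalization

/-! ### The reversed Brascamp–Lieb constant -/

theorem theorem2 {m n : ℕ} {d : Fin m → ℕ} (c : Fin m → ℝ)
    (B : (i : Fin m) → Matrix (Fin (d i)) (Fin n) ℝ)
    (hcB : IsBrascampLiebDatum c B)
    (A : Matrix (Fin n) (Fin n) ℝ) (hA : A.PosDef)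
    (hAB : A⁻¹ = ∑ i, c i • ((B i)ᵀ * (B i * A * (B i)ᵀ)⁻¹ * B i)) :
    IsReversedBrascampLiebConstant c B (ENNReal.ofReal (brascampLiebValue c B A)) ∧
    -- the Gaussian functions are admissible, have positive finite integrals, and give equality
    (IsReversedAdmissible c B (fun i => gaussianFun (B i * A * (B i)ᵀ)) (gaussianFun A) ∧
      (∀ i, Integrable (gaussianFun (B i * A * (B i)ᵀ)) ∧
        0 < ∫ x, gaussianFun (B i * A * (B i)ᵀ) x) ∧
      (Integrable (gaussianFun A) ∧ 0 < ∫ x, gaussianFun A x) ∧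
      ∏ i, (∫ x, gaussianFun (B i * A * (B i)ᵀ) x) ^ c i =
        brascampLiebValue c B A * ∫ x, gaussianFun A x) := by
  obtain ⟨S, T, J, hS, hSu, hT, hTu, hJ, hJx⟩ := exists_normalization hcB hA hAB
  have hTu' : ∀ i, IsUnit ((T i)ᵀ).det := fun i => by rw [Matrix.det_transpose]; exact hTu i
  have hSu' : IsUnit (Sᵀ).det := by rw [Matrix.det_transpose]; exact hSu
  have hS0 : 0 < |S.det| := abs_pos.2 hSu.ne_zero
  have hT0 : ∀ i, 0 < |(T i).det| := fun i => abs_pos.2 (hTu i).ne_zero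
  have hprod0 : 0 < ∏ i, |(T i).det| ^ c i :=
    Finset.prod_pos fun i _ => Real.rpow_pos_of_pos (hT0 i) _
  have hval : brascampLiebValue c B A = |S.det| / ∏ i, |(T i).det| ^ c i := by
    have e : A.det / ∏ i, (B i * A * (B i)ᵀ).det ^ c i =
        (|S.det| / ∏ i, |(T i).det| ^ c i) ^ 2 := by
      rw [div_pow, ← Finset.prod_pow, sq_abs, ← hS, Matrix.det_mul, Matrix.det_transpose, pow_two]
      congr 1
      refine Finset.prod_congr rfl fun i _ => ?_
      rw [hS, ← hT, Matrix.det_mul, Matrix.det_transpose, ← abs_mul_abs_self,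
        Real.mul_rpow (abs_nonneg _) (abs_nonneg _), pow_two]
    rw [brascampLiebValue, e, Real.sqrt_sq (by positivity)]
  have hpd := hcB.posDef hA
  have hadm : IsReversedAdmissible c B (fun i => gaussianFun (B i * A * (B i)ᵀ))
      (gaussianFun A) := by
    refine ⟨fun i x => (Real.exp_pos _).le, fun x => (Real.exp_pos _).le,
      fun i => (measurable_gaussianFun _).aemeasurable, (measurable_gaussianFun _).aemeasurable,
      fun x => ?_⟩
    simp only [← hT, gaussianFun_mul_transpose, ← Real.exp_mul]
    rw [← hS, gaussianFun_mul_transpose, ← Real.exp_sum, Real.exp_le_exp]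
    have h1 := hJ.norm_sq_sum_le fun i => WithLp.toLp 2 ((T i)ᵀ *ᵥ x i)
    have e : WithLp.toLp 2 (Sᵀ *ᵥ ∑ i, c i • ((B i)ᵀ *ᵥ x i)) =
        ∑ i, c i • J i (WithLp.toLp 2 ((T i)ᵀ *ᵥ x i)) := by
      apply WithLp.ofLp_injective 2
      rw [WithLp.ofLp_sum]
      simp only [WithLp.ofLp_smul, hJx, Matrix.mulVec_sum, Matrix.mulVec_smul, Matrix.mulVec_mulVec]
      refine Finset.sum_congr rfl fun i _ => ?_
      rw [Matrix.mul_assoc _ _ ((T i)ᵀ), Matrix.nonsing_inv_mul _ (hTu' i), Matrix.mul_one]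
    rw [e]
    refine le_trans (le_of_eq ?_) (div_le_div_of_nonneg_right (neg_le_neg h1) zero_le_two)
    rw [← Finset.sum_neg_distrib, Finset.sum_div]
    exact Finset.sum_congr rfl fun i _ => by ring
  have heq : ∏ i, (∫ x, gaussianFun (B i * A * (B i)ᵀ) x) ^ c i =
      brascampLiebValue c B A * ∫ x, gaussianFun A x := by
    -- the powers of `2π` cancel by the dimension count
    have hfr := hJ.sum_mul_finrank
    simp only [finrank_euclideanSpace_fin] at hfr
    simp only [← hT]
    rw [hval, ← hS, integral_gaussianFun hSu, ← Real.rpow_natCast, ← hfr,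
      Real.rpow_sum_of_pos (by positivity), ← mul_assoc, div_mul_eq_mul_div,
      mul_inv_cancel₀ hS0.ne', one_div, ← Finset.prod_inv_distrib, ← Finset.prod_mul_distrib]
    refine Finset.prod_congr rfl fun i _ => ?_
    rw [integral_gaussianFun (hTu i), Real.mul_rpow (by positivity) (by positivity),
      Real.inv_rpow (hT0 i).le, ← Real.rpow_natCast, ← Real.rpow_mul (by positivity),
      mul_comm (c i)]
  refine ⟨⟨?_, ?_⟩, hadm,
    fun i => ⟨integrable_gaussianFun (hpd i), integral_gaussianFun_pos (hpd i)⟩,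
    ⟨integrable_gaussianFun hA, integral_gaussianFun_pos hA⟩, heq⟩
  · intro f g hfg
    -- apply the geometric case to `y ↦ f i (T i)⁻ᵀ y` and `y ↦ g (S⁻ᵀ y)`
    have h1 := hJ.prod_lintegral_le (f := fun i y => (f i (((T i)ᵀ)⁻¹ *ᵥ y.ofLp)).toNNReal)
      (g := fun y => ENNReal.ofReal (g ((Sᵀ)⁻¹ *ᵥ y.ofLp))) (by
        intro x
        have h2 := hfg.le fun i => ((T i)ᵀ)⁻¹ *ᵥ (x i).ofLp
        have e : (Sᵀ)⁻¹ *ᵥ (∑ i, c i • J i (x i)).ofLp =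
            ∑ i, c i • ((B i)ᵀ *ᵥ (((T i)ᵀ)⁻¹ *ᵥ (x i).ofLp)) := by
          rw [WithLp.ofLp_sum]
          simp only [WithLp.ofLp_smul, hJx, Matrix.mulVec_sum, Matrix.mulVec_smul,
            Matrix.mulVec_mulVec]
          refine Finset.sum_congr rfl fun i _ => ?_
          rw [Matrix.mul_assoc (Sᵀ), ← Matrix.mul_assoc, Matrix.nonsing_inv_mul _ hSu',
            Matrix.one_mul]
        rw [e]
        refine le_trans (le_of_eq ?_) (ENNReal.ofReal_le_ofReal h2)
        rw [← ENNReal.prod_ofReal_rpow (fun i => hfg.nonneg_left i _) hcB.pos]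
        rfl)
    have hdetT : ∀ i, |(((T i)ᵀ)⁻¹).det|⁻¹ = |(T i).det| := fun i => by
      rw [Matrix.det_nonsing_inv, Matrix.det_transpose, Ring.inverse_eq_inv', abs_inv, inv_inv]
    have hdetS : |((Sᵀ)⁻¹).det|⁻¹ = |S.det| := by
      rw [Matrix.det_nonsing_inv, Matrix.det_transpose, Ring.inverse_eq_inv', abs_inv, inv_inv]
    rw [lintegral_comp_mulVec ((Matrix.isUnit_nonsing_inv_det_iff).2 hSu')
      (fun x => ENNReal.ofReal (g x)), hdetS] at h1
    have h3 : ∀ i, ∫⁻ y : EuclideanSpace ℝ (Fin (d i)),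
        ((f i (((T i)ᵀ)⁻¹ *ᵥ y.ofLp)).toNNReal : ℝ≥0∞) =
        ENNReal.ofReal |(T i).det| * ∫⁻ x, ENNReal.ofReal (f i x) := fun i => by
      rw [← hdetT i]
      exact lintegral_comp_mulVec ((Matrix.isUnit_nonsing_inv_det_iff).2 (hTu' i))
        (fun x => ENNReal.ofReal (f i x))
    simp only [h3, ENNReal.mul_rpow_of_nonneg _ _ (hcB.pos _).le, Finset.prod_mul_distrib] at h1
    rw [ENNReal.prod_ofReal_rpow (fun i => (hT0 i).le) hcB.pos] at h1
    rw [hval, ENNReal.ofReal_div_of_pos hprod0, ENNReal.div_eq_inv_mul, mul_assoc]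
    exact (ENNReal.mul_le_iff_le_inv (ENNReal.ofReal_pos.2 hprod0).ne' ENNReal.ofReal_ne_top).1 h1
  · intro C hC
    have h1 := hC _ _ hadm
    have e : ∀ {k : ℕ} {M : Matrix (Fin k) (Fin k) ℝ}, M.PosDef →
        ∫⁻ x, ENNReal.ofReal (gaussianFun M x) = ENNReal.ofReal (∫ x, gaussianFun M x) :=
      fun hM => (ofReal_integral_eq_lintegral_ofReal (integrable_gaussianFun hM)
        (.of_forall fun x => (Real.exp_pos _).le)).symm
    simp only [e (hpd _), e hA] at h1
    rw [ENNReal.prod_ofReal_rpow (fun i => (integral_gaussianFun_pos (hpd i)).le) hcB.pos, heq,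
      ENNReal.ofReal_mul (p := brascampLiebValue c B A) (Real.sqrt_nonneg _)] at h1
    exact (ENNReal.mul_le_mul_iff_left (by simpa using integral_gaussianFun_pos hA) (by simp)).1 h1
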